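/- Conventions. "Analytic" means real analytic; manifolds are Hausdorff and second countable. A point $x$ of a set $X\subset\mathbb R^n$ is *smooth of dimension $k$* if it has an open neighbourhood $N$ in $\mathbb R^n$ such that $X\cap N$ is an analytic submanifold of $\mathbb R^n$ of dimension $k$. The dimension of a subanalytic set is the highest dimension of its smooth points ($-\infty$ for the empty set). Let $X$ be a closed subanalytic subset of $\mathbb R^n$ of dimension $k$. A *global smoothing section* of $X\subset\mathbb R^n$ is a triple $\Gamma=(X',\varphi,U)$, where $X'$ is an analytic manifold of pure dimension $k$, $\varphi:X'\to\mathbb R^n$ is a proper analytic map, and $U$ is a subanalytic set which is open in $X$ and consists of smooth points of $X$ of dimension $k$, such that 1. $\varphi(X')\subset X$; 2. $\dim(X\setminus U)<k$ and $\varphi^{-1}(X\setminus U)$ is a (possibly empty) simple normal crossings hypersurface of $X'$; 3. for each connected component $W$ of $U$, $\varphi^{-1}(W)$ is the union of a finite nonempty family of subsets of $\varphi^{-1}(U)$, each open and closed in $\varphi^{-1}(U)$ and each mapped by $\varphi$ isomorphically (by an analytic diffeomorphism) onto $W$. The *degree of $\Gamma$ over $W$* is the (finite, positive) number of subsets of $\varphi^{-1}(U)$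 that are open and closed in $\varphi^{-1}(U)$ and are mapped isomorphically onto $W$ by $\varphi$. A subset $Y$ of the set of smooth points of $X$ of dimension $k$ is a *nonbounding equator of $X$* if $k\ge 1$ and 1. $Y$ is a compact $\mathscr C^\infty$ submanifold of $\mathbb R^n$ of dimension $k-1$; 2. $Y$ does not bound: it is not diffeomorphic to the boundary of a compact $\mathscr C^\infty$ manifold with boundary of dimension $k$; 3. $Y$ has a collar in $X$: there is a $\mathscr C^\infty$ diffeomorphism $\psi$ from $Y\times(-1,1)$ onto an open neighbourhood $T$ of $Y$ in the set of smooth points of $X$ of dimension $k$, with $\psi(Y\times\{0\})=Y$; 4. there is a relatively compact open subset $K$ of $X$ such that $\overline K\setminus K=Y$ and $K\cap T=\psi(Y\times(-1,0))$, where $\overline K$ is the closure of $K$ in $X$. **Theorem.** Let $X$ be a closed subanalytic subset of $\mathbb R^n$ of dimension $k$, let $\Gamma=(X',\varphi,U)$ be a global smoothing section of $X\subset\mathbb R^n$, and let $W$ be a connected component of $U$. If $W$ contains a nonbounding equator of $X$, then the degree of $\Gamma$ over $W$ is even. -/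

import Mathlib

open scoped Manifold ContDiff

universe u

namespace GlobalSmoothing

/-! ### Semianalytic and subanalytic sets -/

/-- A subset `S` of a (finite-dimensional) real normed space is semianalytic if every point of the
space has an open neighbourhood in which `S` is a finite union of sets, each defined by an analytic
equation and finitely many strict analytic inequalities. (Several equations are combined by taking a
sum of squares, and `0` and `1` may be used as dummy equation and inequality.) -/
def IsSemianalytic {F : Type*} [NormedAddCommGroup F] [NormedSpace ℝ F] (S : Set F) : Prop :=
  ∀ a : F, ∃ O : Set F, IsOpen O ∧ a ∈ O ∧
    ∃ (p q : ℕ) (f : Fin p → F → ℝ) (g : Fin p → Fin q → F → ℝ),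
      (∀ i, AnalyticOnNhd ℝ (f i) O) ∧ (∀ i j, AnalyticOnNhd ℝ (g i j) O) ∧
      S ∩ O = {x ∈ O | ∃ i, f i x = 0 ∧ ∀ j, 0 < g i j x}

/-- A subset `S` of `ℝⁿ` is subanalytic if every point of `ℝⁿ` has an open neighbourhood in which
`S` is the projection of a relatively compact semianalytic subset of some `ℝⁿ × ℝᵐ`. -/
def IsSubanalytic {n : ℕ} (S : Set (EuclideanSpace ℝ (Fin n))) : Prop :=
  ∀ a : EuclideanSpace ℝ (Fin n), ∃ O : Set (EuclideanSpace ℝ (Fin n)), IsOpen O ∧ a ∈ O ∧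
    ∃ (m : ℕ) (A : Set (EuclideanSpace ℝ (Fin n) × EuclideanSpace ℝ (Fin m))),
      IsSemianalytic A ∧ IsCompact (closure A) ∧ S ∩ O = Prod.fst '' A

/-! ### Submanifolds of `ℝⁿ`, smooth points, dimension -/

/-- `S` is a `C^r` (embedded) submanifold of `ℝⁿ` of pure dimension `k`: around each of its points
there are `C^r` coordinates of `ℝⁿ` in which `S` is the vanishing set of the last `n - k`
coordinates. Here `r = ∞` means smooth and `r = ω` means analytic. -/
def IsSubmanifold (r : WithTop ℕ∞) {n : ℕ} (k : ℕ) (S : Set (EuclideanSpace ℝ (Fin n))) : Prop :=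
  ∀ x ∈ S, k ≤ n ∧
    ∃ e : OpenPartialHomeomorph (EuclideanSpace ℝ (Fin n)) (EuclideanSpace ℝ (Fin n)),
      x ∈ e.source ∧ ContDiffOn ℝ r e e.source ∧ ContDiffOn ℝ r e.symm e.target ∧
      ∀ y ∈ e.source, y ∈ S ↔ ∀ i : Fin n, k ≤ (i : ℕ) → e y i = 0

/-- The set of smooth points of `X` of dimension `k`. -/
def smoothPart {n : ℕ} (k : ℕ) (X : Set (EuclideanSpace ℝ (Fin n))) :
    Set (EuclideanSpace ℝ (Fin n)) :=
  {x ∈ X | ∃ N : Set (EuclideanSpace ℝ (Fin n)), IsOpen N ∧ x ∈ N ∧ IsSubmanifold ω k (X ∩ N)}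

/-- The dimension of a subanalytic set: the highest dimension of its smooth points
(`⊥` for the empty set). -/
noncomputable def subanalyticDim {n : ℕ} (X : Set (EuclideanSpace ℝ (Fin n))) : WithBot ℕ∞ :=
  ⨆ (j : ℕ) (_ : (smoothPart j X).Nonempty), (((j : ℕ∞)) : WithBot ℕ∞)

/-! ### Smooth maps and diffeomorphisms between subsets of manifolds -/

section Maps

variable {EP HP P EQ HQ Q : Type*}
  [NormedAddCommGroup EP] [NormedSpace ℝ EP] [TopologicalSpace HP]
  [TopologicalSpace P] [ChartedSpace HP P]
  [NormedAddCommGroup EQ] [NormedSpace ℝ EQ] [TopologicalSpace HQ]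
  [TopologicalSpace Q] [ChartedSpace HQ Q]

/-- A map `f` from a subset `S` of a manifold `P` to a manifold `Q` is `C^r` if locally it extends
to a `C^r` map on an open subset of `P`. (For submanifolds `S` this is the usual notion.) -/
def IsSmoothOnSubset (I : ModelWithCorners ℝ EP HP) (J : ModelWithCorners ℝ EQ HQ)
    (r : WithTop ℕ∞) {S : Set P} (f : S → Q) : Prop :=
  ∀ x : S, ∃ O : Set P, IsOpen O ∧ (x : P) ∈ O ∧
    ∃ g : P → Q, ContMDiffOn I J r g O ∧ ∀ y : S, (y : P) ∈ O → g y = f y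

/-- A bijection between a subset of `P` and a subset of `Q` is a `C^r` diffeomorphism if it is `C^r`
in both directions. -/
structure IsDiffeo (I : ModelWithCorners ℝ EP HP) (J : ModelWithCorners ℝ EQ HQ)
    (r : WithTop ℕ∞) {S : Set P} {T : Set Q} (e : S ≃ T) : Prop where
  smooth : IsSmoothOnSubset I J r (fun x : S => (e x : Q))
  smooth_symm : IsSmoothOnSubset J I r (fun y : T => (e.symm y : P))

end Maps

/-! ### Global smoothing sections -/

section Smoothing

variable {n k : ℕ} {X' : Type u} [TopologicalSpace X'] [ChartedSpace (EuclideanSpace ℝ (Fin k)) X']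

/-- `B` is a simple normal crossings hypersurface of the `k`-dimensional analytic manifold `X'`: it
is the union of a family `𝓗` of sets such that around each point `a` of `X'` there are analytic
coordinates centred at `a` in which the members of `𝓗` through `a` are pairwise distinct coordinate
hyperplanes, while the other members are absent. In particular the members of `𝓗` are closed
analytic submanifolds of codimension one, and `𝓗` is locally finite. -/
def IsSNCHypersurface (k : ℕ) {X' : Type u} [TopologicalSpace X']
    [ChartedSpace (EuclideanSpace ℝ (Fin k)) X'] (B : Set X') : Prop :=
  ∃ 𝓗 : Set (Set X'), B = ⋃₀ 𝓗 ∧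
    ∀ a : X', ∃ e ∈ IsManifold.maximalAtlas (𝓡 k) ω X', a ∈ e.source ∧ e a = 0 ∧
      ∃ c : {H : Set X' // H ∈ 𝓗 ∧ a ∈ H} → Fin k, Function.Injective c ∧
        (∀ H : {H : Set X' // H ∈ 𝓗 ∧ a ∈ H},
          (H : Set X') ∩ e.source = {x ∈ e.source | e x (c H) = 0}) ∧
        (∀ H ∈ 𝓗, a ∉ H → H ∩ e.source = ∅)

/-- The subsets of `φ⁻¹(U)` which are open and closed in `φ⁻¹(U)` and which `φ` maps isomorphically
(by an analytic diffeomorphism) onto `W`. -/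
def sheets (φ : X' → EuclideanSpace ℝ (Fin n)) (U W : Set (EuclideanSpace ℝ (Fin n))) :
    Set (Set X') :=
  {A | A ⊆ φ ⁻¹' U ∧ IsClopen ((↑) ⁻¹' A : Set (φ ⁻¹' U)) ∧
    ∃ e : A ≃ W, IsDiffeo (𝓡 k) (𝓡 n) ω e ∧ ∀ a : A, (e a : EuclideanSpace ℝ (Fin n)) = φ a}

/-- The degree over `W`: the number of sheets over `W`. -/
noncomputable def degree (φ : X' → EuclideanSpace ℝ (Fin n))
    (U W : Set (EuclideanSpace ℝ (Fin n))) : ℕ :=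
  (sheets (k := k) φ U W).ncard

/-- `(X', φ, U)` is a global smoothing section of the subset `X` of `ℝⁿ` of dimension `k`, where `X'`
is an analytic manifold of pure dimension `k`. -/
structure IsGlobalSmoothingSection (X : Set (EuclideanSpace ℝ (Fin n)))
    (φ : X' → EuclideanSpace ℝ (Fin n)) (U : Set (EuclideanSpace ℝ (Fin n))) : Prop where
  analytic : ContMDiff (𝓡 k) (𝓡 n) ω φ
  proper : IsProperMap φ
  /-- `U` is contained in the smooth part of `X` of dimension `k`. -/
  subset_smoothPart : U ⊆ smoothPart k X
  /-- `U` is open in `X`. -/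
  isOpen : ∃ O : Set (EuclideanSpace ℝ (Fin n)), IsOpen O ∧ U = X ∩ O
  subanalytic : IsSubanalytic U
  range_subset : Set.range φ ⊆ X
  dim_diff_lt : subanalyticDim (X \ U) < ((k : ℕ∞) : WithBot ℕ∞)
  snc : IsSNCHypersurface k (φ ⁻¹' (X \ U))
  /-- Over each connected component `W` of `U`, there are finitely many sheets, at least one, and
  `φ⁻¹(W)` is their union. -/
  sheets_finite : ∀ x ∈ U, (sheets (k := k) φ U (connectedComponentIn U x)).Finite
  sheets_nonempty : ∀ x ∈ U, (sheets (k := k) φ U (connectedComponentIn U x)).Nonempty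
  sUnion_sheets : ∀ x ∈ U,
    ⋃₀ sheets (k := k) φ U (connectedComponentIn U x) = φ ⁻¹' connectedComponentIn U x

end Smoothing

/-! ### Nonbounding equators -/

/-- The `m`-dimensional submanifold `Y` of `ℝⁿ` bounds: it is (diffeomorphic to) the boundary of a
compact smooth manifold with boundary `M` of dimension `m + 1`. -/
def Bounds {n : ℕ} (m : ℕ) (Y : Set (EuclideanSpace ℝ (Fin n))) : Prop :=
  ∃ (M : Type u) (_ : TopologicalSpace M) (_ : T2Space M) (_ : CompactSpace M)
    (_ : ChartedSpace (EuclideanHalfSpace (m + 1)) M) (_ : IsManifold (𝓡∂ (m + 1)) ∞ M)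
    (e : (𝓡∂ (m + 1)).boundary M ≃ Y), IsDiffeo (𝓡∂ (m + 1)) (𝓡 n) ∞ e

/-- `Y` is a nonbounding equator of the closed subanalytic subset `X` of `ℝⁿ` of dimension `k`.
The first field excludes `k = 0`, where `Y` would have dimension `-1`, that is, would be empty, and
the empty manifold bounds. -/
structure IsNonboundingEquator {n : ℕ} (k : ℕ) (X Y : Set (EuclideanSpace ℝ (Fin n))) : Prop where
  one_le : 1 ≤ k
  subset_smoothPart : Y ⊆ smoothPart k X
  isCompact : IsCompact Y
  isSubmanifold : IsSubmanifold ∞ (k - 1) Y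
  not_bounds : ¬ Bounds.{u} (k - 1) Y
  /-- There are a collar `ψ` of `Y` in `X`, with image `T`, and a relatively compact open subset `K`
  of `X` with frontier `Y` which meets `T` in the negative half of the collar. -/
  collar : ∃ (T : Set (EuclideanSpace ℝ (Fin n)))
      (ψ : (Y ×ˢ Set.Ioo (-1 : ℝ) 1 : Set (EuclideanSpace ℝ (Fin n) × ℝ)) ≃ T)
      (K : Set (EuclideanSpace ℝ (Fin n))),
    T ⊆ smoothPart k X ∧ Y ⊆ T ∧
    (∃ O : Set (EuclideanSpace ℝ (Fin n)), IsOpen O ∧ T = smoothPart k X ∩ O) ∧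
    IsDiffeo 𝓘(ℝ, EuclideanSpace ℝ (Fin n) × ℝ) (𝓡 n) ∞ ψ ∧
    (fun p => (ψ p : EuclideanSpace ℝ (Fin n))) '' {p | p.1.2 = 0} = Y ∧
    (∃ O : Set (EuclideanSpace ℝ (Fin n)), IsOpen O ∧ K = X ∩ O) ∧
    IsCompact (closure K) ∧ closure K \ K = Y ∧
    K ∩ T = (fun p => (ψ p : EuclideanSpace ℝ (Fin n))) '' {p | p.1.2 < 0}

end GlobalSmoothing

namespace GlobalSmoothing

open Set Filter Topology

/-! ### Quotients of compact Hausdorff spaces -/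

/-! Suppose that the degree over `W` is odd. As `φ` is proper, the preimage `P` of the closure of
`K` is compact, and it lies in the manifold `X'`, so that singularities of `X` inside `K` do no
harm. Near the equator `Y ⊆ W` the map `φ` is a trivial covering whose sheets are those over `W`.
Hence `P` is a compact domain whose boundary is a disjoint union of collared copies of `Y`, one for
each sheet (`exists_collaredDomain`).

An odd number of copies can be paired off with exactly one left over
(`exists_involutive_of_odd_card`). Gluing the paired copies along the identity of `Y`, which needs
no orientation, turns `P` into a compact smooth manifold whose boundary is the remaining copy
(`CollaredDomain.bounds`). So `Y` bounds, a contradiction.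

The work lies in the smooth structure of the quotient. The collars of two paired copies join into a
tube across their common seam. A parametrization is called good if locally it factors smoothly, in
both directions, through the interior `Q` of `P` or through the tubes. Any two good ones are
compatible (`IsGood.compatible`), so interior, seam and boundary charts are each checked once
instead of pairwise. -/

theorem t2Space_quotient_of_isClosed {P : Type*} [TopologicalSpace P] [CompactSpace P] [T2Space P]
    (s : Setoid P) (h : IsClosed {q : P × P | s q.1 q.2}) : T2Space (Quotient s) := by
  -- The saturation of a closed set is a projection, along a compact factor, of a closed part of the
  -- relation.
  have hcl : ∀ C : Set P, IsClosed C → IsClosed (Quotient.mk s '' C) := by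
    intro C hC
    rw [← isQuotientMap_quotient_mk'.isClosed_preimage]
    have : Quotient.mk s ⁻¹' (Quotient.mk s '' C)
        = Prod.snd '' ({q : P × P | s q.1 q.2} ∩ Prod.fst ⁻¹' C) := by
      ext x
      simp only [mem_preimage, mem_image, mem_inter_iff, mem_ofPred_eq, Prod.exists,
        exists_eq_right]
      exact exists_congr fun a => ⟨fun ⟨h1, h2⟩ => ⟨Quotient.exact h2, h1⟩,
        fun ⟨h1, h2⟩ => ⟨h2, Quotient.sound h1⟩⟩
    exact this ▸ isClosedMap_snd_of_compactSpace _ (h.inter (hC.preimage continuous_fst))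
  have hfib : ∀ a : P, IsClosed (Quotient.mk s ⁻¹' {Quotient.mk s a}) := fun a => by
    refine IsClosed.preimage continuous_quotient_mk' ?_
    simpa using hcl {a} isClosed_singleton
  refine ⟨fun x y hxy => ?_⟩
  obtain ⟨a, rfl⟩ := Quotient.exists_rep x
  obtain ⟨b, rfl⟩ := Quotient.exists_rep y
  have hd : Disjoint (Quotient.mk s ⁻¹' {Quotient.mk s a}) (Quotient.mk s ⁻¹' {Quotient.mk s b}) := by
    rw [Set.disjoint_left]
    intro c hc hc'
    exact hxy (hc.symm.trans hc')
  -- Two distinct classes are disjoint closed sets in a normal space. The classes contained entirely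
  -- in `A`, respectively in `B`, form the separating open sets.
  obtain ⟨A, B, hA, hB, haA, hbB, hAB⟩ := normal_separation (hfib a) (hfib b) hd
  refine ⟨(Quotient.mk s '' Aᶜ)ᶜ, (Quotient.mk s '' Bᶜ)ᶜ, (hcl _ hA.isClosed_compl).isOpen_compl,
    (hcl _ hB.isClosed_compl).isOpen_compl, ?_, ?_, ?_⟩
  · rintro ⟨c, hc, hc'⟩
    exact hc (haA hc')
  · rintro ⟨c, hc, hc'⟩
    exact hc (hbB hc')
  · rw [Set.disjoint_left]
    intro z hz hz'
    obtain ⟨c, rfl⟩ := Quotient.exists_rep z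
    have h1 : c ∈ A := by
      by_contra hc
      exact hz ⟨c, hc, rfl⟩
    have h2 : c ∈ B := by
      by_contra hc
      exact hz' ⟨c, hc, rfl⟩
    exact Set.disjoint_left.1 hAB h1 h2

/-! ### Manifolds with boundary from compatible parametrizations -/

/-- A parametrization of an open subset of `M` by a relatively open subset of the half space of
dimension `m + 1`. -/
structure HalfSpaceParam (m : ℕ) (M : Type*) [TopologicalSpace M] where
  toFun : EuclideanSpace ℝ (Fin (m + 1)) → M
  dom : Set (EuclideanSpace ℝ (Fin (m + 1)))
  dom_open : ∃ O : Set (EuclideanSpace ℝ (Fin (m + 1))), IsOpen O ∧ dom = {z | 0 ≤ z 0} ∩ O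
  continuousOn : ContinuousOn toFun dom
  injOn : InjOn toFun dom
  isOpen_image : ∀ O, IsOpen O → IsOpen (toFun '' (dom ∩ O))

namespace HalfSpaceParam

variable {m : ℕ} {M : Type*} [TopologicalSpace M]

/-- The inverse of a parametrization, as a chart. -/
noncomputable def chart (p : HalfSpaceParam m M) :
    OpenPartialHomeomorph M (EuclideanHalfSpace (m + 1)) :=
  (OpenPartialHomeomorph.ofContinuousOpenRestrict
    (BijOn.toPartialEquiv (fun h : EuclideanHalfSpace (m + 1) => p.toFun h.1)
      (Subtype.val ⁻¹' p.dom) ((fun h : EuclideanHalfSpace (m + 1) => p.toFun h.1) ''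
      (Subtype.val ⁻¹' p.dom))
      (InjOn.bijOn_image fun _ ha _ hb hab => Subtype.ext (p.injOn ha hb hab)))
    (p.continuousOn.comp continuous_subtype_val.continuousOn fun _ hx => hx)
    (by
      rintro S ⟨S', hS', rfl⟩
      obtain ⟨S'', hS'', rfl⟩ := hS'
      convert p.isOpen_image S'' hS'' using 1
      ext y
      constructor
      · rintro ⟨⟨h, hh⟩, hs, rfl⟩
        exact ⟨h.1, ⟨hh, hs⟩, rfl⟩
      · rintro ⟨z, ⟨hz, hz'⟩, rfl⟩
        obtain ⟨O, hO, hd⟩ := p.dom_open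
        exact ⟨⟨⟨z, (hd ▸ hz : z ∈ {z | 0 ≤ z 0} ∩ O).1⟩, hz⟩, hz', rfl⟩)
    (by
      obtain ⟨O, hO, hd⟩ := p.dom_open
      refine ⟨O, hO, ?_⟩
      ext h
      change _ ↔ h.1 ∈ p.dom
      rw [hd]
      exact ⟨fun hh => ⟨h.2, hh⟩, fun hh => hh.2⟩)).symm

theorem nonneg_of_mem_dom (p : HalfSpaceParam m M) {z : EuclideanSpace ℝ (Fin (m + 1))}
    (hz : z ∈ p.dom) : 0 ≤ z 0 := by
  obtain ⟨O, hO, hd⟩ := p.dom_open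
  rw [hd] at hz
  exact hz.1

theorem chart_symm_apply (p : HalfSpaceParam m M) (h : EuclideanHalfSpace (m + 1)) :
    p.chart.symm h = p.toFun h.1 := rfl

theorem chart_source (p : HalfSpaceParam m M) : p.chart.source = p.toFun '' p.dom := by
  change (fun h : EuclideanHalfSpace (m + 1) => p.toFun h.1) '' (Subtype.val ⁻¹' p.dom) = _
  ext y
  constructor
  · rintro ⟨h, hh, rfl⟩
    exact ⟨h.1, hh, rfl⟩
  · rintro ⟨z, hz, rfl⟩
    exact ⟨⟨z, p.nonneg_of_mem_dom hz⟩, hz, rfl⟩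

theorem chart_apply (p : HalfSpaceParam m M) {z : EuclideanSpace ℝ (Fin (m + 1))}
    (hz : z ∈ p.dom) : (p.chart (p.toFun z)).1 = z := by
  have : p.chart (p.chart.symm ⟨z, p.nonneg_of_mem_dom hz⟩) = ⟨z, p.nonneg_of_mem_dom hz⟩ :=
    p.chart.right_inv hz
  exact congrArg Subtype.val this

/-- The transition maps from `p` to `q` extend to smooth maps. -/
def Compatible (p q : HalfSpaceParam m M) : Prop :=
  ∀ z ∈ p.dom, ∀ w ∈ q.dom, p.toFun z = q.toFun w →
    ∃ θ : EuclideanSpace ℝ (Fin (m + 1)) → EuclideanSpace ℝ (Fin (m + 1)),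
      ContDiffAt ℝ ∞ θ z ∧
      ∀ᶠ z' in 𝓝[{z | 0 ≤ z 0}] z, θ z' ∈ q.dom ∧ q.toFun (θ z') = p.toFun z'

/-- On the half space, smoothness at a point only asks for a smooth function agreeing with the
transition nearby within the half space, and `θ` is one. -/
theorem Compatible.contDiffOn {p q : HalfSpaceParam m M} (h : Compatible p q) :
    ContDiffOn ℝ ∞ ((𝓡∂ (m + 1)) ∘ p.chart.symm ≫ₕ q.chart ∘ (𝓡∂ (m + 1)).symm)
      ((𝓡∂ (m + 1)).symm ⁻¹' (p.chart.symm ≫ₕ q.chart).source ∩ range (𝓡∂ (m + 1))) := by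
  rintro z ⟨hz, hzr⟩
  rw [range_modelWithCornersEuclideanHalfSpace] at hzr ⊢
  have hsymm : ∀ z' : EuclideanSpace ℝ (Fin (m + 1)), (hz' : 0 ≤ z' 0) →
      (𝓡∂ (m + 1)).symm z' = ⟨z', hz'⟩ := fun z' hz' =>
    (𝓡∂ (m + 1)).left_inv ⟨z', hz'⟩
  have hzr' : 0 ≤ z 0 := hzr
  have hz0 := hz
  rw [mem_preimage, hsymm z hzr'] at hz
  obtain ⟨hz1, hz2⟩ := hz
  have hz1' : z ∈ p.dom := hz1
  have hz2' : p.toFun z ∈ q.chart.source := hz2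
  rw [chart_source] at hz2'
  obtain ⟨w, hw, hpw⟩ := hz2'
  obtain ⟨θ, hθ, hev⟩ := h z hz1' w hw hpw.symm
  refine ContDiffWithinAt.congr_of_eventuallyEq (f := θ) hθ.contDiffWithinAt ?_ ?_
  · have h2 : ∀ᶠ z' in 𝓝[{z | 0 ≤ z 0}] z, z' ∈ {z : EuclideanSpace ℝ (Fin (m + 1)) | 0 ≤ z 0} :=
      self_mem_nhdsWithin
    refine Filter.Eventually.filter_mono (nhdsWithin_mono z inter_subset_right) ?_
    filter_upwards [hev, h2] with z' hz' hz'2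
    change (q.chart (p.chart.symm ((𝓡∂ (m + 1)).symm z'))).1 = θ z'
    rw [hsymm z' hz'2, chart_symm_apply, ← hz'.2, chart_apply _ hz'.1]
  · have h3 := hev.self_of_nhdsWithin hzr'
    change (q.chart (p.chart.symm ((𝓡∂ (m + 1)).symm z))).1 = θ z
    rw [hsymm z hzr', chart_symm_apply, ← h3.2, chart_apply _ h3.1]

/-- The charted space structure given by a covering family of parametrizations. -/
@[reducible] noncomputable def chartedSpace (S : Set (HalfSpaceParam m M)) (c : M → HalfSpaceParam m M)
    (hc : ∀ x, c x ∈ S) (hx : ∀ x, x ∈ (c x).toFun '' (c x).dom) :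
    ChartedSpace (EuclideanHalfSpace (m + 1)) M where
  atlas := chart '' S
  chartAt x := (c x).chart
  mem_chart_source x := by
    rw [chart_source]
    exact hx x
  chart_mem_atlas x := ⟨c x, hc x, rfl⟩

theorem isManifold (S : Set (HalfSpaceParam m M)) (c : M → HalfSpaceParam m M)
    (hc : ∀ x, c x ∈ S) (hx : ∀ x, x ∈ (c x).toFun '' (c x).dom)
    (h : ∀ p ∈ S, ∀ q ∈ S, Compatible p q) :
    @IsManifold _ _ _ _ _ _ _ (𝓡∂ (m + 1)) ∞ M _ (chartedSpace S c hc hx) := by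
  let := chartedSpace S c hc hx
  refine isManifold_of_contDiffOn _ _ _ ?_
  rintro e e' ⟨p, hp, rfl⟩ ⟨q, hq, rfl⟩
  exact (h p hp q hq).contDiffOn

end HalfSpaceParam

/-! ### Coordinates on Euclidean spaces -/

/-- The vector with first coordinate `w.1` and remaining coordinates `w.2`. -/
noncomputable def consCoord {m : ℕ} (w : ℝ × EuclideanSpace ℝ (Fin m)) :
    EuclideanSpace ℝ (Fin (m + 1)) :=
  WithLp.toLp 2 (Fin.cons w.1 w.2)

/-- The vector of all coordinates but the first. -/
noncomputable def tailCoord {m : ℕ} (z : EuclideanSpace ℝ (Fin (m + 1))) :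
    EuclideanSpace ℝ (Fin m) :=
  WithLp.toLp 2 fun i => z i.succ

@[simp] theorem consCoord_zero {m : ℕ} (w : ℝ × EuclideanSpace ℝ (Fin m)) :
    consCoord w 0 = w.1 := rfl

@[simp] theorem tailCoord_consCoord {m : ℕ} (w : ℝ × EuclideanSpace ℝ (Fin m)) :
    tailCoord (consCoord w) = w.2 := rfl

@[simp] theorem consCoord_tailCoord {m : ℕ} (z : EuclideanSpace ℝ (Fin (m + 1))) :
    consCoord (z 0, tailCoord z) = z := by
  ext i
  refine Fin.cases rfl (fun j => rfl) i

theorem contDiff_coord {m : ℕ} (i : Fin m) {r : WithTop ℕ∞} :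
    ContDiff ℝ r fun z : EuclideanSpace ℝ (Fin m) => z i :=
  contDiff_euclidean.1 contDiff_id i

theorem contDiff_consCoord {m : ℕ} {r : WithTop ℕ∞} : ContDiff ℝ r (consCoord (m := m)) := by
  refine contDiff_euclidean.2 fun i => ?_
  refine Fin.cases contDiff_fst (fun j => ?_) i
  exact (contDiff_coord j).comp contDiff_snd

theorem contDiff_tailCoord {m : ℕ} {r : WithTop ℕ∞} : ContDiff ℝ r (tailCoord (m := m)) :=
  contDiff_euclidean.2 fun i => contDiff_coord i.succ

/-- The vector whose first coordinates are those of `v`, the others being zero. -/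
noncomputable def padCoord {m : ℕ} (n : ℕ) (v : EuclideanSpace ℝ (Fin m)) :
    EuclideanSpace ℝ (Fin n) :=
  WithLp.toLp 2 fun i => if h : (i : ℕ) < m then v ⟨i, h⟩ else 0

/-- The vector of the first `m` coordinates. -/
noncomputable def truncCoord {m n : ℕ} (h : m ≤ n) (z : EuclideanSpace ℝ (Fin n)) :
    EuclideanSpace ℝ (Fin m) :=
  WithLp.toLp 2 fun i => z (Fin.castLE h i)

theorem contDiff_padCoord {m n : ℕ} {r : WithTop ℕ∞} : ContDiff ℝ r (padCoord (m := m) n) := by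
  refine contDiff_euclidean.2 fun i => ?_
  by_cases h : (i : ℕ) < m
  · simpa [padCoord, h] using contDiff_coord (⟨i, h⟩ : Fin m)
  · simpa [padCoord, h] using contDiff_const

theorem contDiff_truncCoord {m n : ℕ} (h : m ≤ n) {r : WithTop ℕ∞} :
    ContDiff ℝ r (truncCoord h) :=
  contDiff_euclidean.2 fun _ => contDiff_coord _

theorem truncCoord_padCoord {m n : ℕ} (h : m ≤ n) (v : EuclideanSpace ℝ (Fin m)) :
    truncCoord h (padCoord n v) = v := by
  ext i
  simp [truncCoord, padCoord]

theorem padCoord_apply_of_le {m n : ℕ} (v : EuclideanSpace ℝ (Fin m)) (i : Fin n) (hi : m ≤ i) :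
    padCoord n v i = 0 := by
  simp [padCoord, hi]

theorem padCoord_truncCoord {m n : ℕ} (h : m ≤ n) (z : EuclideanSpace ℝ (Fin n))
    (hz : ∀ i : Fin n, m ≤ (i : ℕ) → z i = 0) : padCoord n (truncCoord h z) = z := by
  ext i
  by_cases hi : (i : ℕ) < m
  · simp [padCoord, truncCoord, hi]
  · simp [padCoord, hi, hz i (not_lt.1 hi)]

/-- A smooth parametrization `q` of a relatively open subset of `Y`, whose inverse extends to a
smooth map `r` on an open subset of the ambient space. -/
structure LocalParam (m : ℕ) {n : ℕ} (Y : Set (EuclideanSpace ℝ (Fin n))) where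
  V : Set (EuclideanSpace ℝ (Fin m))
  O : Set (EuclideanSpace ℝ (Fin n))
  q : EuclideanSpace ℝ (Fin m) → EuclideanSpace ℝ (Fin n)
  r : EuclideanSpace ℝ (Fin n) → EuclideanSpace ℝ (Fin m)
  isOpen_V : IsOpen V
  isOpen_O : IsOpen O
  contDiffOn_q : ContDiffOn ℝ ∞ q V
  contDiffOn_r : ContDiffOn ℝ ∞ r O
  q_mem : ∀ v ∈ V, q v ∈ Y
  q_mem_O : ∀ v ∈ V, q v ∈ O
  r_mem : ∀ y ∈ O, r y ∈ V
  r_q : ∀ v ∈ V, r (q v) = v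
  q_r : ∀ y ∈ O, y ∈ Y → q (r y) = y

theorem IsSubmanifold.exists_localParam {m n : ℕ} {Y : Set (EuclideanSpace ℝ (Fin n))}
    (h : IsSubmanifold ∞ m Y) {y : EuclideanSpace ℝ (Fin n)} (hy : y ∈ Y) :
    ∃ c : LocalParam m Y, y ∈ c.O := by
  obtain ⟨hmn, e, hye, he, he', hY⟩ := h y hy
  have hpad := contDiff_padCoord (m := m) (n := n) (r := ∞)
  have htr := contDiff_truncCoord hmn (r := ∞)
  have hQ : ∀ x ∈ e.source, x ∈ Y → padCoord n (truncCoord hmn (e x)) = e x :=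
    fun x hx hxY => padCoord_truncCoord hmn _ ((hY x hx).1 hxY)
  have hmemY : ∀ v, padCoord n v ∈ e.target → e.symm (padCoord n v) ∈ Y := fun v hv => by
    rw [hY _ (e.map_target hv)]
    intro i hi
    rw [e.right_inv hv]
    exact padCoord_apply_of_le v i hi
  -- The open set `O` is cut down so that `r` sends all of it into `V`, including its points off
  -- `Y`.
  refine ⟨⟨padCoord n ⁻¹' e.target,
    e.source ∩ (fun x => padCoord n (truncCoord hmn (e x))) ⁻¹' e.target,
    fun v => e.symm (padCoord n v), fun x => truncCoord hmn (e x),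
    e.open_target.preimage hpad.continuous,
    ((hpad.continuous.comp htr.continuous).comp_continuousOn
      e.continuousOn).isOpen_inter_preimage e.open_source e.open_target,
    he'.comp hpad.contDiffOn (fun _ hv => hv),
    htr.comp_contDiffOn (he.mono inter_subset_left),
    hmemY, ?_, fun x hx => hx.2, ?_, ?_⟩, hye, ?_⟩
  · intro v hv
    refine ⟨e.map_target hv, ?_⟩
    rw [mem_preimage, e.right_inv hv, truncCoord_padCoord]
    exact hv
  · intro v hv
    simp only [e.right_inv hv, truncCoord_padCoord]
  · intro x hx hxY
    simp only [hQ x hx.1 hxY, e.left_inv hx.1]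
  · rw [mem_preimage, hQ y hye hy]
    exact e.map_source hye

/-! ### Gluing boundary components of a compact domain -/

/-- A compact subset `P` of a manifold, which is the union of the open set `Q` and of its boundary;
the boundary consists of copies of `Y`, indexed by `ι`, and the copy of index `s` has a collar
`β s : Y × (-ε, ε) → Ω s` with inverse `ρ`, which meets `Q` in its negative half. -/
structure CollaredDomain (ι : Type*) {n : ℕ} (m : ℕ) (X' : Type u) [TopologicalSpace X']
    [ChartedSpace (EuclideanSpace ℝ (Fin (m + 1))) X'] (Y : Set (EuclideanSpace ℝ (Fin n))) where
  P : Set X'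
  Q : Set X'
  Ω : ι → Set X'
  β : ι → EuclideanSpace ℝ (Fin n) × ℝ → X'
  ρ : X' → EuclideanSpace ℝ (Fin n) × ℝ
  ε : ℝ
  ε_pos : 0 < ε
  isCompact_P : IsCompact P
  isOpen_Q : IsOpen Q
  subset : Q ⊆ P
  isOpen_Ω : ∀ s, IsOpen (Ω s)
  eq_of_mem : ∀ s s' x, x ∈ Ω s → x ∈ Ω s' → s = s'
  β_mem : ∀ s, ∀ w : EuclideanSpace ℝ (Fin n) × ℝ, w.1 ∈ Y → |w.2| < ε → β s w ∈ Ω s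
  ρ_β : ∀ s, ∀ w : EuclideanSpace ℝ (Fin n) × ℝ, w.1 ∈ Y → |w.2| < ε → ρ (β s w) = w
  ρ_mem : ∀ s, ∀ x ∈ Ω s, (ρ x).1 ∈ Y ∧ |(ρ x).2| < ε
  β_ρ : ∀ s, ∀ x ∈ Ω s, β s (ρ x) = x
  contMDiffOn_ρ : ∀ s,
    ContMDiffOn (𝓡 (m + 1)) 𝓘(ℝ, EuclideanSpace ℝ (Fin n) × ℝ) ∞ ρ (Ω s)
  exists_extension : ∀ s, ∀ w : EuclideanSpace ℝ (Fin n) × ℝ, w.1 ∈ Y → |w.2| < ε →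
    ∃ g : EuclideanSpace ℝ (Fin n) × ℝ → X',
      ContMDiffAt 𝓘(ℝ, EuclideanSpace ℝ (Fin n) × ℝ) (𝓡 (m + 1)) ∞ g w ∧
      ∀ᶠ w' in 𝓝 w, w'.1 ∈ Y → g w' = β s w'
  mem_Q : ∀ s, ∀ x ∈ Ω s, (x ∈ Q ↔ (ρ x).2 < 0)
  mem_P : ∀ s, ∀ x ∈ Ω s, (x ∈ P ↔ (ρ x).2 ≤ 0)
  exists_mem_Ω : ∀ x ∈ P, x ∉ Q → ∃ s, x ∈ Ω s

namespace CollaredDomain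

variable {ι : Type*} {m n : ℕ} {X' : Type u} [TopologicalSpace X']
  [ChartedSpace (EuclideanSpace ℝ (Fin (m + 1))) X'] {Y : Set (EuclideanSpace ℝ (Fin n))}
  (D : CollaredDomain ι m X' Y) (σ : ι → ι) {M : Type*} [TopologicalSpace M] {F : X' → M}

theorem abs_zero_lt : |(0 : ℝ)| < D.ε := by
  rw [abs_zero]
  exact D.ε_pos

theorem β_mem_Q_iff {s : ι} {w : EuclideanSpace ℝ (Fin n) × ℝ} (hw : w.1 ∈ Y)
    (hw' : |w.2| < D.ε) : D.β s w ∈ D.Q ↔ w.2 < 0 := by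
  rw [D.mem_Q s _ (D.β_mem s w hw hw'), D.ρ_β s w hw hw']

theorem β_mem_P_iff {s : ι} {w : EuclideanSpace ℝ (Fin n) × ℝ} (hw : w.1 ∈ Y)
    (hw' : |w.2| < D.ε) : D.β s w ∈ D.P ↔ w.2 ≤ 0 := by
  rw [D.mem_P s _ (D.β_mem s w hw hw'), D.ρ_β s w hw hw']

theorem β_injective {s s' : ι} {w w' : EuclideanSpace ℝ (Fin n) × ℝ} (hw : w.1 ∈ Y)
    (hw' : |w.2| < D.ε) (hv : w'.1 ∈ Y) (hv' : |w'.2| < D.ε) (h : D.β s w = D.β s' w') :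
    s = s' ∧ w = w' := by
  refine ⟨D.eq_of_mem s s' _ (D.β_mem s w hw hw') (h ▸ D.β_mem s' w' hv hv'), ?_⟩
  rw [← D.ρ_β s w hw hw', h, D.ρ_β s' w' hv hv']

/-- The identification of boundary points of the copies of `Y` with indices exchanged by `σ`. -/
def Rel (x x' : X') : Prop :=
  x = x' ∨ ∃ s, ∃ y ∈ Y, x = D.β s (y, 0) ∧ x' = D.β (σ s) (y, 0)

/-- `F` exhibits `M` as the quotient of `P` by the identification of boundary points. -/
structure IsGluing (F : X' → M) : Prop where
  involutive : Function.Involutive σ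
  eq_iff : ∀ x ∈ D.P, ∀ x' ∈ D.P, (F x = F x' ↔ D.Rel σ x x')
  surjective : ∀ a : M, ∃ x ∈ D.P, F x = a
  isOpen_iff : ∀ S : Set M, IsOpen S ↔ ∃ G : Set X', IsOpen G ∧ ∀ x ∈ D.P, (F x ∈ S ↔ x ∈ G)

open Classical in
/-- The collars of index `s` and `σ s`, glued along `Y`. -/
noncomputable def tube (F : X' → M) (s : ι) (w : EuclideanSpace ℝ (Fin n) × ℝ) : M :=
  if w.2 ≤ 0 then F (D.β s w) else F (D.β (σ s) (w.1, -w.2))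

variable {D σ}

omit [TopologicalSpace M] in
theorem tube_zero (s : ι) (y : EuclideanSpace ℝ (Fin n)) :
    D.tube σ F s (y, 0) = F (D.β s (y, 0)) := by
  simp [tube]

namespace IsGluing

variable (hF : D.IsGluing σ F)
include hF

theorem continuousOn : ContinuousOn F D.P := by
  rw [continuousOn_iff']
  intro S hS
  obtain ⟨G, hG, h⟩ := (hF.isOpen_iff S).1 hS
  refine ⟨G, hG, ?_⟩
  ext x
  exact ⟨fun hx => ⟨(h x hx.2).1 hx.1, hx.2⟩, fun hx => ⟨(h x hx.2).2 hx.1, hx.2⟩⟩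

/-- Only points of collar coordinate `0` are identified with others, and these lie outside `Q`;
classes of points of `Q` are singletons. -/
theorem not_mem_Q_of_boundary {x : X'} (hx : x ∈ D.Q) {s : ι} {y : EuclideanSpace ℝ (Fin n)}
    (hy : y ∈ Y) : F x ≠ F (D.β s (y, 0)) := by
  intro h
  have hyQ : ∀ s, D.β s (y, 0) ∉ D.Q := fun s => by
    rw [D.β_mem_Q_iff (w := (y, 0)) hy D.abs_zero_lt]
    exact lt_irrefl _
  have hyP : D.β s (y, 0) ∈ D.P := (D.β_mem_P_iff (w := (y, 0)) hy D.abs_zero_lt).2 le_rfl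
  rcases (hF.eq_iff x (D.subset hx) _ hyP).1 h with h | ⟨s', y', hy', h1, -⟩
  · exact hyQ s (h ▸ hx)
  · have := (D.β_mem_Q_iff (s := s') (w := (y', 0)) hy' D.abs_zero_lt).1 (h1 ▸ hx)
    exact lt_irrefl _ this

theorem eq_of_mem_Q {x x' : X'} (hx : x ∈ D.Q) (hx' : x' ∈ D.P) (h : F x = F x') : x = x' := by
  rcases (hF.eq_iff x (D.subset hx) x' hx').1 h with h | ⟨s', y', hy', h1, -⟩
  · exact h
  · exact (hF.not_mem_Q_of_boundary hx hy' (congrArg F h1)).elim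

theorem boundary_eq_iff {s s' : ι} {y y' : EuclideanSpace ℝ (Fin n)} (hy : y ∈ Y) (hy' : y' ∈ Y) :
    F (D.β s (y, 0)) = F (D.β s' (y', 0)) ↔ y = y' ∧ (s' = s ∨ s' = σ s) := by
  have hP : ∀ s, ∀ y ∈ Y, D.β s (y, 0) ∈ D.P := fun s y hy =>
    (D.β_mem_P_iff (w := (y, 0)) hy D.abs_zero_lt).2 le_rfl
  rw [hF.eq_iff _ (hP s y hy) _ (hP s' y' hy')]
  constructor
  · rintro (h | ⟨t, v, hv, h1, h2⟩)
    · obtain ⟨h1, h2⟩ := D.β_injective (w := (y, 0)) (w' := (y', 0)) hy D.abs_zero_lt hy'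
        D.abs_zero_lt h
      exact ⟨congrArg Prod.fst h2, Or.inl h1.symm⟩
    · obtain ⟨h3, h4⟩ := D.β_injective (w := (y, 0)) (w' := (v, 0)) hy D.abs_zero_lt hv
        D.abs_zero_lt h1
      obtain ⟨h5, h6⟩ := D.β_injective (w := (y', 0)) (w' := (v, 0)) hy' D.abs_zero_lt hv
        D.abs_zero_lt h2
      exact ⟨congrArg Prod.fst (h4.trans h6.symm), Or.inr (h3 ▸ h5)⟩
  · rintro ⟨rfl, rfl | rfl⟩
    · exact Or.inl rfl
    · exact Or.inr ⟨s, y, hy, rfl, rfl⟩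

theorem boundary_σ (s : ι) {y : EuclideanSpace ℝ (Fin n)} (hy : y ∈ Y) :
    F (D.β (σ s) (y, 0)) = F (D.β s (y, 0)) :=
  ((hF.boundary_eq_iff hy hy).2 ⟨rfl, Or.inr rfl⟩).symm

/-- The same tube seen from its other side. If `σ s = s`, the tube is folded: both halves run over
one collar. This is the origin of the recurring condition `σ s = s → w.2 ≤ 0`. -/
theorem tube_σ (s : ι) {w : EuclideanSpace ℝ (Fin n) × ℝ} (hw : w.1 ∈ Y) :
    D.tube σ F (σ s) w = D.tube σ F s (w.1, -w.2) := by
  unfold tube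
  rcases lt_trichotomy w.2 0 with h | h | h
  · rw [if_pos h.le, if_neg (by simpa using h)]
    simp
  · rw [if_pos h.le, if_pos (by simp [h])]
    obtain ⟨y, t⟩ := w
    subst h
    simpa using hF.boundary_σ s hw
  · rw [if_neg (not_le.2 h), if_pos (by simpa using h.le), hF.involutive s]

/-- A point of the interior in a tube, in collar coordinates. -/
theorem exists_collar_of_tube {s : ι} {w : EuclideanSpace ℝ (Fin n) × ℝ} (hw : w.1 ∈ Y)
    (hw' : |w.2| < D.ε) {x : X'} (hx : x ∈ D.Q) (h : D.tube σ F s w = F x) :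
    ∃ (s' : ι) (δ : ℝ), (δ = 1 ∨ δ = -1) ∧ δ * w.2 < 0 ∧ x = D.β s' (w.1, δ * w.2) ∧
      (w.2 < 0 → δ = 1) ∧
      ∀ v : EuclideanSpace ℝ (Fin n) × ℝ, δ * v.2 < 0 →
        D.tube σ F s v = F (D.β s' (v.1, δ * v.2)) := by
  -- The sign `δ` records the half: `1` on the collar of `s`, `-1` on the reflected collar of `σ s`.
  -- A seam point cannot come from `Q`.
  rcases lt_trichotomy w.2 0 with hs | hs | hs
  · refine ⟨s, 1, Or.inl rfl, by simpa using hs, ?_, fun _ => rfl, ?_⟩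
    · rw [tube, if_pos hs.le] at h
      simpa using hF.eq_of_mem_Q hx (D.subset ((D.β_mem_Q_iff hw hw').2 hs)) h.symm
    · intro v hv
      rw [one_mul] at hv ⊢
      rw [tube, if_pos hv.le]
  · obtain ⟨y, t⟩ := w
    simp only at hs hw
    subst hs
    rw [tube_zero] at h
    exact (hF.not_mem_Q_of_boundary hx hw h.symm).elim
  · refine ⟨σ s, -1, Or.inr rfl, by simpa using hs, ?_, fun h => absurd h hs.not_gt, ?_⟩
    · rw [tube, if_neg hs.not_ge] at h
      have := hF.eq_of_mem_Q hx (D.subset ((D.β_mem_Q_iff (s := σ s) (w := (w.1, -w.2)) hw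
        (by simpa using hw')).2 (by simpa using hs))) h.symm
      simpa using this
    · intro v hv
      have hv' : 0 < v.2 := by linarith
      rw [tube, if_neg hv'.not_ge, neg_one_mul]

/-- Off the seam the tube is `F` after a collar, up to a reflection of the interval, so a local
extension of the collar is a smooth lift to `X'`. -/
theorem exists_lift_of_tube {s : ι} {w : EuclideanSpace ℝ (Fin n) × ℝ} (hw : w.1 ∈ Y)
    (hw' : |w.2| < D.ε) {x : X'} (hx : x ∈ D.Q) (h : D.tube σ F s w = F x) :
    ∃ g : EuclideanSpace ℝ (Fin n) × ℝ → X',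
      ContMDiffAt 𝓘(ℝ, EuclideanSpace ℝ (Fin n) × ℝ) (𝓡 (m + 1)) ∞ g w ∧ g w = x ∧
      ∀ᶠ v in 𝓝 w, v.1 ∈ Y → g v ∈ D.Q ∧ D.tube σ F s v = F (g v) := by
  obtain ⟨s', δ, hδ, hneg, hxw, -, hv⟩ := hF.exists_collar_of_tube hw hw' hx h
  have habs : ∀ t : ℝ, |δ * t| = |t| := fun t => by
    rcases hδ with rfl | rfl <;> simp
  obtain ⟨g, hg, hgβ⟩ := D.exists_extension s' (w.1, δ * w.2) hw (by simpa [habs] using hw')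
  have hsm : ContDiff ℝ ∞ fun v : EuclideanSpace ℝ (Fin n) × ℝ => (v.1, δ * v.2) := by fun_prop
  refine ⟨fun v => g (v.1, δ * v.2), ?_, ?_, ?_⟩
  · exact ContMDiffAt.comp w hg hsm.contMDiff.contMDiffAt
  · rw [hxw]
    exact hgβ.self_of_nhds hw
  · have h1 := (hsm.continuous.tendsto w).eventually hgβ
    have h2 : ∀ᶠ v : EuclideanSpace ℝ (Fin n) × ℝ in 𝓝 w, δ * v.2 < 0 :=
      (isOpen_lt (by fun_prop) continuous_const).mem_nhds hneg
    have h3 : ∀ᶠ v : EuclideanSpace ℝ (Fin n) × ℝ in 𝓝 w, |v.2| < D.ε :=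
      (isOpen_lt (by fun_prop) continuous_const).mem_nhds hw'
    filter_upwards [h1, h2, h3] with v h1 h2 h3 hvY
    rw [h1 hvY]
    exact ⟨(D.β_mem_Q_iff (w := (v.1, δ * v.2)) hvY (by simpa [habs] using h3)).2 h2, hv v h2⟩

/-- The inverse of the collar is `ρ`, corrected by the sign `δ`. -/
theorem exists_colift_of_tube {s : ι} {w : EuclideanSpace ℝ (Fin n) × ℝ} (hw : w.1 ∈ Y)
    (hw' : |w.2| < D.ε) (hs : σ s = s → w.2 ≤ 0) {x : X'} (hx : x ∈ D.Q)
    (h : D.tube σ F s w = F x) :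
    ∃ g : X' → EuclideanSpace ℝ (Fin n) × ℝ,
      ContMDiffAt (𝓡 (m + 1)) 𝓘(ℝ, EuclideanSpace ℝ (Fin n) × ℝ) ∞ g x ∧ g x = w ∧
      ∀ᶠ x' in 𝓝 x, (g x').1 ∈ Y ∧ (σ s = s → (g x').2 ≤ 0) ∧ D.tube σ F s (g x') = F x' := by
  obtain ⟨s', δ, hδ, hneg, hxw, hδ', hv⟩ := hF.exists_collar_of_tube hw hw' hx h
  have habs : ∀ t : ℝ, |δ * t| = |t| := fun t => by
    rcases hδ with rfl | rfl <;> simp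
  have hδδ : ∀ t : ℝ, δ * (δ * t) = t := fun t => by
    rcases hδ with rfl | rfl <;> simp
  have hsm : ContDiff ℝ ∞ fun v : EuclideanSpace ℝ (Fin n) × ℝ => (v.1, δ * v.2) := by fun_prop
  have hw'' : |(w.1, δ * w.2).2| < D.ε := by simpa [habs] using hw'
  have hxΩ : x ∈ D.Ω s' := hxw ▸ D.β_mem s' _ hw hw''
  have hρx : D.ρ x = (w.1, δ * w.2) := by rw [hxw, D.ρ_β s' (w.1, δ * w.2) hw hw'']
  have hΩ := (D.isOpen_Ω s').mem_nhds hxΩ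
  refine ⟨fun x' => ((D.ρ x').1, δ * (D.ρ x').2), ?_, ?_, ?_⟩
  · exact hsm.contMDiff.contMDiffAt.comp x ((D.contMDiffOn_ρ s').contMDiffAt hΩ)
  · simp [hρx, hδδ]
  · filter_upwards [hΩ, D.isOpen_Q.mem_nhds hx] with x' h1 h2
    have h3 := (D.mem_Q s' x' h1).1 h2
    refine ⟨(D.ρ_mem s' x' h1).1, fun hss => ?_, ?_⟩
    · have h4 : w.2 < 0 := by
        rcases (hs hss).lt_or_eq with h4 | h4
        · exact h4
        · rw [h4, mul_zero] at hneg
          exact (lt_irrefl _ hneg).elim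
      simp only [hδ' h4, one_mul]
      exact h3.le
    · rw [hv _ (by simpa [hδδ] using h3)]
      simp only [hδδ]
      exact congrArg F (D.β_ρ s' x' h1)

/-- A boundary class is met only by the tubes of `s` and `σ s`, and the change of coordinates
between these is the identity or the reflection. -/
theorem tube_eq_boundary {s s' : ι} {w : EuclideanSpace ℝ (Fin n) × ℝ} (hw : w.1 ∈ Y)
    (hw' : |w.2| < D.ε) {y : EuclideanSpace ℝ (Fin n)} (hy : y ∈ Y)
    (h : D.tube σ F s w = F (D.β s' (y, 0))) :
    w = (y, 0) ∧ (σ s' = s' ↔ σ s = s) ∧ ∃ δ : ℝ, (δ = 1 ∨ δ = -1) ∧ (σ s = s → δ = 1) ∧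
      ∀ v : EuclideanSpace ℝ (Fin n) × ℝ, v.1 ∈ Y →
        D.tube σ F s v = D.tube σ F s' (v.1, δ * v.2) := by
  rcases lt_trichotomy w.2 0 with hs | hs | hs
  · rw [tube, if_pos hs.le] at h
    exact (hF.not_mem_Q_of_boundary ((D.β_mem_Q_iff hw hw').2 hs) hy h).elim
  · obtain ⟨y', t⟩ := w
    simp only at hs hw
    subst hs
    rw [tube_zero, hF.boundary_eq_iff hw hy] at h
    obtain ⟨rfl, h⟩ := h
    refine ⟨rfl, ?_⟩
    by_cases hss : s' = s
    · subst hss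
      exact ⟨Iff.rfl, 1, Or.inl rfl, fun _ => rfl, fun v hv => by simp⟩
    · have hs' : s' = σ s := h.resolve_left hss
      subst hs'
      refine ⟨?_, -1, Or.inr rfl, fun h => absurd h hss, fun v hv => ?_⟩
      · rw [hF.involutive s, eq_comm]
      · rw [neg_one_mul, hF.tube_σ s (w := (v.1, -v.2)) hv]
        simp
  · rw [tube, if_neg hs.not_ge] at h
    refine (hF.not_mem_Q_of_boundary ((D.β_mem_Q_iff (w := (w.1, -w.2)) hw ?_).2 ?_) hy h).elim
    · simpa using hw'
    · simpa using hs

/-- Each half is injective because `F` is injective on `Q`; the two halves can overlap off the seam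
only if the tube is folded, which the sign conditions exclude. -/
theorem tube_injective {s : ι} {w w' : EuclideanSpace ℝ (Fin n) × ℝ} (hw : w.1 ∈ Y)
    (hwε : |w.2| < D.ε) (hw' : w'.1 ∈ Y) (hwε' : |w'.2| < D.ε) (hs : σ s = s → w.2 ≤ 0)
    (hs' : σ s = s → w'.2 ≤ 0) (h : D.tube σ F s w = D.tube σ F s w') : w = w' := by
  have key : ∀ v v' : EuclideanSpace ℝ (Fin n) × ℝ, v.1 ∈ Y → |v.2| < D.ε → v'.1 ∈ Y →
      |v'.2| < D.ε → (σ s = s → v'.2 ≤ 0) → v.2 < 0 →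
      D.tube σ F s v = D.tube σ F s v' → v = v' := by
    intro v v' hv hvε hv' hvε' hvs hneg h
    have hQ := (D.β_mem_Q_iff (s := s) hv hvε).2 hneg
    have h1 : D.tube σ F s v = F (D.β s v) := by rw [tube, if_pos hneg.le]
    obtain ⟨s₁, δ, hδ, h2, h3, h4, -⟩ := hF.exists_collar_of_tube hv' hvε' hQ (h.symm.trans h1)
    have habs : |(v'.1, δ * v'.2).2| < D.ε := by
      rcases hδ with rfl | rfl <;> simpa using hvε'
    obtain ⟨h5, h6⟩ := D.β_injective hv hvε (w' := (v'.1, δ * v'.2)) hv' habs h3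
    rcases hδ with rfl | rfl
    · simpa using h6
    -- Opposite signs put one point in the collar of `s` and in that of `σ s`, whence `σ s = s`, and
    -- then `v'.2 ≤ 0`.
    · have hpos : 0 < v'.2 := by linarith
      have h7 : D.tube σ F s v' = F (D.β (σ s) (v'.1, -v'.2)) := by
        rw [tube, if_neg hpos.not_ge]
      have h8 := hF.eq_of_mem_Q hQ (D.subset ((D.β_mem_Q_iff (s := σ s) (w := (v'.1, -v'.2)) hv'
        (by simpa using hvε')).2 (by simpa using hpos))) (h1.symm.trans (h.trans h7))
      have h9 := (D.β_injective hv hvε (w' := (v'.1, -v'.2)) hv' (by simpa using hvε') h8).1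
      exact absurd (hvs h9.symm) hpos.not_ge
  have key2 : ∀ v v' : EuclideanSpace ℝ (Fin n) × ℝ, v.1 ∈ Y → |v.2| < D.ε → v'.1 ∈ Y →
      |v'.2| < D.ε → v.2 = 0 → D.tube σ F s v = D.tube σ F s v' → v = v' := by
    intro v v' hv hvε hv' hvε' h0 h
    obtain ⟨y, t⟩ := v
    simp only at h0 hv
    subst h0
    rw [tube_zero] at h
    exact (hF.tube_eq_boundary hv' hvε' hv h.symm).1.symm
  rcases lt_trichotomy w.2 0 with h0 | h0 | h0
  · exact key w w' hw hwε hw' hwε' hs' h0 h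
  · exact key2 w w' hw hwε hw' hwε' h0 h
  · rcases lt_trichotomy w'.2 0 with h0' | h0' | h0'
    · exact (key w' w hw' hwε' hw hwε hs h0' h.symm).symm
    · exact (key2 w' w hw' hwε' hw hwε h0' h.symm).symm
    · have h1 : D.tube σ F s w = F (D.β (σ s) (w.1, -w.2)) := by rw [tube, if_neg h0.not_ge]
      have h2 : D.tube σ F s w' = F (D.β (σ s) (w'.1, -w'.2)) := by rw [tube, if_neg h0'.not_ge]
      have h3 := hF.eq_of_mem_Q ((D.β_mem_Q_iff (s := σ s) (w := (w.1, -w.2)) hw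
        (by simpa using hwε)).2 (by simpa using h0)) (D.subset ((D.β_mem_Q_iff (s := σ s)
        (w := (w'.1, -w'.2)) hw' (by simpa using hwε')).2 (by simpa using h0')))
        (h1.symm.trans (h.trans h2))
      have h4 := (D.β_injective (w := (w.1, -w.2)) hw (by simpa using hwε)
        (w' := (w'.1, -w'.2)) hw' (by simpa using hwε') h3).2
      rw [Prod.mk.injEq, neg_inj] at h4
      exact Prod.ext h4.1 h4.2

theorem continuousWithinAt_tube (s : ι) {y : EuclideanSpace ℝ (Fin n)} (hy : y ∈ Y) :
    ContinuousWithinAt (D.tube σ F s) {w | w.1 ∈ Y} (y, 0) := by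
  have hε : ∀ᶠ w : EuclideanSpace ℝ (Fin n) × ℝ in 𝓝 (y, 0), |w.2| < D.ε :=
    (isOpen_lt (by fun_prop) continuous_const).mem_nhds D.abs_zero_lt
  -- `F` is controlled on `P` only, so the limit is taken along the half where the collar lies in
  -- `P`. The two halves of the tube are then pasted, their limits agreeing by `boundary_σ`.
  have key : ∀ s, Tendsto (fun w => F (D.β s w)) (𝓝[{w | w.1 ∈ Y ∧ w.2 ≤ 0}] (y, 0))
      (𝓝 (F (D.β s (y, 0)))) := by
    intro s
    obtain ⟨g, hg, hgβ⟩ := D.exists_extension s (y, 0) hy D.abs_zero_lt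
    have hP : D.β s (y, 0) ∈ D.P := (D.β_mem_P_iff (w := (y, 0)) hy D.abs_zero_lt).2 le_rfl
    have h1 : Tendsto (D.β s) (𝓝[{w | w.1 ∈ Y ∧ w.2 ≤ 0}] (y, 0)) (𝓝[D.P] (D.β s (y, 0))) := by
      refine tendsto_nhdsWithin_iff.2 ⟨?_, ?_⟩
      · have h2 := hg.continuousAt.tendsto.mono_left
          (nhdsWithin_le_nhds (s := {w | w.1 ∈ Y ∧ w.2 ≤ 0}))
        rw [hgβ.self_of_nhds hy] at h2
        refine h2.congr' ?_
        filter_upwards [mem_nhdsWithin_of_mem_nhds hgβ, self_mem_nhdsWithin] with w h3 h4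
        exact h3 h4.1
      · filter_upwards [mem_nhdsWithin_of_mem_nhds hε, self_mem_nhdsWithin] with w h3 h4
        exact (D.β_mem_P_iff h4.1 h3).2 h4.2
    exact (hF.continuousOn _ hP).tendsto.comp h1
  have hunion : {w : EuclideanSpace ℝ (Fin n) × ℝ | w.1 ∈ Y}
      ⊆ {w | w.1 ∈ Y ∧ w.2 ≤ 0} ∪ {w | w.1 ∈ Y ∧ 0 < w.2} := fun w hw =>
    (le_or_gt w.2 0).imp (fun h => ⟨hw, h⟩) fun h => ⟨hw, h⟩
  refine ContinuousWithinAt.mono (ContinuousWithinAt.union ?_ ?_) hunion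
  · rw [ContinuousWithinAt, tube_zero]
    refine (key s).congr' ?_
    filter_upwards [self_mem_nhdsWithin] with w hw
    rw [tube, if_pos hw.2]
  · rw [ContinuousWithinAt, tube_zero, ← hF.boundary_σ s hy]
    have hneg : Tendsto (fun w : EuclideanSpace ℝ (Fin n) × ℝ => (w.1, -w.2))
        (𝓝[{w | w.1 ∈ Y ∧ 0 < w.2}] (y, 0)) (𝓝[{w | w.1 ∈ Y ∧ w.2 ≤ 0}] (y, 0)) := by
      refine tendsto_nhdsWithin_iff.2 ⟨?_, ?_⟩
      · have : Continuous fun w : EuclideanSpace ℝ (Fin n) × ℝ => (w.1, -w.2) := by fun_prop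
        simpa using (this.tendsto (y, 0)).mono_left
          (nhdsWithin_le_nhds (s := {w | w.1 ∈ Y ∧ 0 < w.2}))
      · filter_upwards [self_mem_nhdsWithin] with w hw
        exact ⟨hw.1, by simpa using hw.2.le⟩
    refine ((key (σ s)).comp hneg).congr' ?_
    filter_upwards [self_mem_nhdsWithin] with w hw
    rw [tube, if_neg hw.2.not_ge]
    rfl

end IsGluing

end CollaredDomain

/-! ### Good parametrizations of the glued space -/

namespace CollaredDomain

variable {ι : Type*} {m n : ℕ} {X' : Type u} [TopologicalSpace X']
  [ChartedSpace (EuclideanSpace ℝ (Fin (m + 1))) X'] {Y : Set (EuclideanSpace ℝ (Fin n))}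
  (D : CollaredDomain ι m X' Y) (σ : ι → ι) {M : Type*} [TopologicalSpace M] (F : X' → M)

/-- The map `p` is an injective parametrization of part of `M`, compatible with the smooth
structure of `Q` and with the tubes. -/
structure IsGood (p : EuclideanSpace ℝ (Fin (m + 1)) → M)
    (dom : Set (EuclideanSpace ℝ (Fin (m + 1)))) : Prop where
  dom_open : ∃ O : Set (EuclideanSpace ℝ (Fin (m + 1))), IsOpen O ∧ dom = {z | 0 ≤ z 0} ∩ O
  injOn : InjOn p dom
  lift : ∀ z ∈ dom, ∀ x ∈ D.Q, p z = F x →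
    ∃ a : EuclideanSpace ℝ (Fin (m + 1)) → X', ContMDiffAt (𝓡 (m + 1)) (𝓡 (m + 1)) ∞ a z ∧
      a z = x ∧ ∀ᶠ z' in 𝓝[{z | 0 ≤ z 0}] z, a z' ∈ D.Q ∧ p z' = F (a z')
  colift : ∀ z ∈ dom, ∀ x ∈ D.Q, p z = F x →
    ∃ b : X' → EuclideanSpace ℝ (Fin (m + 1)), ContMDiffAt (𝓡 (m + 1)) (𝓡 (m + 1)) ∞ b x ∧
      b x = z ∧ ∀ᶠ x' in 𝓝 x, b x' ∈ dom ∧ p (b x') = F x'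
  tube_lift : ∀ z ∈ dom, ∀ s, ∀ y ∈ Y, p z = F (D.β s (y, 0)) →
    ∃ a : EuclideanSpace ℝ (Fin (m + 1)) → EuclideanSpace ℝ (Fin n) × ℝ,
      ContDiffAt ℝ ∞ a z ∧ a z = (y, 0) ∧ ∀ᶠ z' in 𝓝[{z | 0 ≤ z 0}] z,
        (a z').1 ∈ Y ∧ (σ s = s → (a z').2 ≤ 0) ∧ p z' = D.tube σ F s (a z')
  tube_colift : ∀ z ∈ dom, ∀ s, ∀ y ∈ Y, p z = F (D.β s (y, 0)) →
    ∃ b : EuclideanSpace ℝ (Fin n) × ℝ → EuclideanSpace ℝ (Fin (m + 1)),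
      ContDiffAt ℝ ∞ b (y, 0) ∧ b (y, 0) = z ∧ ∀ᶠ w in 𝓝 (y, (0 : ℝ)),
        w.1 ∈ Y → (σ s = s → w.2 ≤ 0) → b w ∈ dom ∧ p (b w) = D.tube σ F s w

variable {D σ F}

theorem boundary_of_not_mem_Q {x : X'} (hx : x ∈ D.P) (hx' : x ∉ D.Q) :
    ∃ s, ∃ y ∈ Y, x = D.β s (y, 0) ∧ x ∈ D.Ω s ∧ D.ρ x = (y, 0) := by
  obtain ⟨s, hs⟩ := D.exists_mem_Ω x hx hx'
  have h1 := (D.mem_P s x hs).1 hx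
  have h2 := mt (D.mem_Q s x hs).2 hx'
  have h3 : D.ρ x = ((D.ρ x).1, 0) := Prod.ext rfl (le_antisymm h1 (not_lt.1 h2))
  refine ⟨s, (D.ρ x).1, (D.ρ_mem s x hs).1, ?_, hs, h3⟩
  rw [← h3, D.β_ρ s x hs]

namespace IsGood

variable {p : EuclideanSpace ℝ (Fin (m + 1)) → M} {dom : Set (EuclideanSpace ℝ (Fin (m + 1)))}

omit [TopologicalSpace M] in
-- This treats interior and boundary points of `P` alike: a continuous local section of `p` over
-- `F`, from which openness of images follows.
theorem exists_preimage_neighborhood (h : D.IsGood σ F p dom)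
    {z : EuclideanSpace ℝ (Fin (m + 1))} (hz : z ∈ dom) {x : X'} (hx : x ∈ D.P) (hp : p z = F x) :
    ∃ b : X' → EuclideanSpace ℝ (Fin (m + 1)), ContinuousAt b x ∧ b x = z ∧
      ∀ᶠ x' in 𝓝 x, x' ∈ D.P → b x' ∈ dom ∧ p (b x') = F x' := by
  by_cases hxQ : x ∈ D.Q
  · obtain ⟨b, hb, hbx, hev⟩ := h.colift z hz x hxQ hp
    exact ⟨b, hb.continuousAt, hbx, hev.mono fun _ h _ => h⟩
  · obtain ⟨s, y, hy, hxy, hxΩ, hρ⟩ := boundary_of_not_mem_Q hx hxQ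
    obtain ⟨b, hb, hbx, hev⟩ := h.tube_colift z hz s y hy (hxy ▸ hp)
    have hΩ := (D.isOpen_Ω s).mem_nhds hxΩ
    have hc : ContinuousAt D.ρ x := ((D.contMDiffOn_ρ s).contMDiffAt hΩ).continuousAt
    refine ⟨b ∘ D.ρ, ContinuousAt.comp (hρ ▸ hb.continuousAt) hc, ?_, ?_⟩
    · rw [Function.comp_apply, hρ, hbx]
    · have hev' := hc.eventually (hρ.symm ▸ hev)
      filter_upwards [hev', hΩ] with x' h1 h2 h3
      have h4 := (D.mem_P s x' h2).1 h3
      have h5 := h1 (D.ρ_mem s x' h2).1 fun _ => h4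
      rw [tube, if_pos h4, D.β_ρ s x' h2] at h5
      exact h5

theorem isOpen_image (hF : D.IsGluing σ F) (h : D.IsGood σ F p dom)
    {O : Set (EuclideanSpace ℝ (Fin (m + 1)))} (hO : IsOpen O) : IsOpen (p '' (dom ∩ O)) := by
  rw [hF.isOpen_iff]
  -- Points outside `P` are admitted freely, so that openness is tested in `X'` and not in `P`.
  refine ⟨interior {x | x ∈ D.P → F x ∈ p '' (dom ∩ O)}, isOpen_interior, fun x hx => ⟨?_, ?_⟩⟩
  · rintro ⟨z, ⟨hz, hzO⟩, hp⟩
    rw [mem_interior_iff_mem_nhds]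
    obtain ⟨b, hb, hbx, hev⟩ := h.exists_preimage_neighborhood hz hx hp
    filter_upwards [hev, hb.preimage_mem_nhds (hO.mem_nhds (hbx.symm ▸ hzO))] with x' h1 h2 h3
    exact ⟨b x', ⟨(h1 h3).1, h2⟩, (h1 h3).2⟩
  · exact fun h => interior_subset h hx

theorem continuousOn (hF : D.IsGluing σ F) (h : D.IsGood σ F p dom) : ContinuousOn p dom := by
  intro z hz
  obtain ⟨O, hO, hd⟩ := h.dom_open
  have hsub : dom ⊆ {z | 0 ≤ z 0} := hd ▸ inter_subset_left
  refine ContinuousWithinAt.mono ?_ hsub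
  obtain ⟨x, hx, hxz⟩ := hF.surjective (p z)
  by_cases hxQ : x ∈ D.Q
  · obtain ⟨a, ha, haz, hev⟩ := h.lift z hz x hxQ hxz.symm
    have h1 : ContinuousAt F (a z) :=
      (hF.continuousOn.mono D.subset).continuousAt (D.isOpen_Q.mem_nhds (haz.symm ▸ hxQ))
    refine (h1.comp ha.continuousAt).continuousWithinAt.congr_of_eventuallyEq ?_ ?_
    · exact hev.mono fun _ h => h.2
    · rw [Function.comp_apply, haz, hxz]
  · obtain ⟨s, y, hy, hxy, hxΩ, hρ⟩ := boundary_of_not_mem_Q hx hxQ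
    obtain ⟨a, ha, haz, hev⟩ := h.tube_lift z hz s y hy (hxy ▸ hxz.symm)
    have h1 := hF.continuousWithinAt_tube s hy
    rw [← haz] at h1
    have h2 : Tendsto a (𝓝[{z | 0 ≤ z 0}] z) (𝓝[{w | w.1 ∈ Y}] (a z)) :=
      tendsto_nhdsWithin_iff.2 ⟨ha.continuousAt.continuousWithinAt, hev.mono fun _ h => h.1⟩
    have h3 := h1.tendsto.comp h2
    rw [haz, tube_zero, ← hxy, hxz] at h3
    exact h3.congr' (hev.mono fun _ h => h.2.2.symm)

/-- A good parametrization, bundled. -/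
def toParam (hF : D.IsGluing σ F) (h : D.IsGood σ F p dom) : HalfSpaceParam m M where
  toFun := p
  dom := dom
  dom_open := h.dom_open
  continuousOn := h.continuousOn hF
  injOn := h.injOn
  isOpen_image _ hO := h.isOpen_image hF hO

/-- The transition is a lift through the first parametrization followed by a colift through the
second. They meet in `X'` over interior classes, and in the coordinates of a tube over boundary
classes. -/
theorem compatible (hF : D.IsGluing σ F) {p p' : HalfSpaceParam m M}
    (h : D.IsGood σ F p.toFun p.dom) (h' : D.IsGood σ F p'.toFun p'.dom) :
    HalfSpaceParam.Compatible p p' := by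
  intro z hz w hw hzw
  obtain ⟨x, hx, hxz⟩ := hF.surjective (p.toFun z)
  by_cases hxQ : x ∈ D.Q
  · obtain ⟨a, ha, haz, hev⟩ := h.lift z hz x hxQ hxz.symm
    obtain ⟨b, hb, hbx, hev'⟩ := h'.colift w hw x hxQ (hzw.symm.trans hxz.symm)
    rw [← haz] at hb hev'
    refine ⟨b ∘ a, (hb.comp z ha).contDiffAt, ?_⟩
    filter_upwards [hev, mem_nhdsWithin_of_mem_nhds (ha.continuousAt.eventually hev')] with z' h1 h2
    exact ⟨h2.1, h2.2.trans h1.2.symm⟩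
  · obtain ⟨s, y, hy, hxy, hxΩ, hρ⟩ := boundary_of_not_mem_Q hx hxQ
    obtain ⟨a, ha, haz, hev⟩ := h.tube_lift z hz s y hy (hxy ▸ hxz.symm)
    obtain ⟨b, hb, hbx, hev'⟩ := h'.tube_colift w hw s y hy (hzw.symm.trans (hxy ▸ hxz.symm))
    rw [← haz] at hb hev'
    refine ⟨b ∘ a, hb.comp z ha, ?_⟩
    filter_upwards [hev, mem_nhdsWithin_of_mem_nhds (ha.continuousAt.eventually hev')]
      with z' h1 h2
    have h3 := h2 h1.1 h1.2.1
    exact ⟨h3.1, h3.2.trans h1.2.2.symm⟩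

end IsGood

/-! #### Construction of good parametrizations -/

theorem exists_isGood_of_mem_Q [IsManifold (𝓡 (m + 1)) ∞ X'] (hF : D.IsGluing σ F) {x : X'}
    (hx : x ∈ D.Q) : ∃ p dom, D.IsGood σ F p dom ∧ ∃ z ∈ dom, 0 < z 0 ∧ p z = F x := by
  set c := chartAt (EuclideanSpace ℝ (Fin (m + 1))) x with hc
  have hcm : c ∈ IsManifold.maximalAtlas (𝓡 (m + 1)) ∞ X' :=
    IsManifold.chart_mem_maximalAtlas x
  -- The chart `c` ignores the half space. The logarithm of the first coordinate opens `{z | 0 < z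
  -- 0}` to the whole space, so interior points stay off the face `z 0 = 0`.
  set lg : EuclideanSpace ℝ (Fin (m + 1)) → EuclideanSpace ℝ (Fin (m + 1)) :=
    fun z => consCoord (Real.log (z 0), tailCoord z) with hlg
  set ex : EuclideanSpace ℝ (Fin (m + 1)) → EuclideanSpace ℝ (Fin (m + 1)) :=
    fun z => consCoord (Real.exp (z 0), tailCoord z) with hex
  have hexlg : ∀ z, 0 < z 0 → ex (lg z) = z := fun z hz => by
    simp [hex, hlg, Real.exp_log hz]
  have hlgex : ∀ z, lg (ex z) = z := fun z => by simp [hex, hlg]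
  have hexpos : ∀ z, 0 < ex z 0 := fun z => by simp [hex, Real.exp_pos]
  have hlgsm : ∀ z, 0 < z 0 → ContDiffAt ℝ ∞ lg z := fun z hz =>
    contDiff_consCoord.contDiffAt.comp z (((contDiff_coord 0).contDiffAt.log hz.ne').prodMk
      contDiff_tailCoord.contDiffAt)
  have hexsm : ContDiff ℝ ∞ ex :=
    contDiff_consCoord.comp ((Real.contDiff_exp.comp (contDiff_coord 0)).prodMk contDiff_tailCoord)
  set dom : Set (EuclideanSpace ℝ (Fin (m + 1))) :=
    {z | 0 < z 0} ∩ lg ⁻¹' (c.target ∩ c.symm ⁻¹' D.Q) with hdom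
  have hpos : IsOpen {z : EuclideanSpace ℝ (Fin (m + 1)) | 0 < z 0} :=
    isOpen_lt continuous_const (contDiff_coord 0 (r := 0)).continuous
  have hopen : IsOpen dom :=
    ContinuousOn.isOpen_inter_preimage
      (fun z hz => (hlgsm z hz).continuousAt.continuousWithinAt) hpos
      (c.isOpen_inter_preimage_symm D.isOpen_Q)
  have hmem : ∀ z ∈ dom, ∀ x' ∈ D.Q, F (c.symm (lg z)) = F x' → c.symm (lg z) = x' :=
    fun z hz x' hx' h => hF.eq_of_mem_Q hz.2.2 (D.subset hx') h
  refine ⟨fun z => F (c.symm (lg z)), dom, ⟨⟨dom, hopen, ?_⟩, ?_, ?_, ?_, ?_, ?_⟩, ex (c x), ?_,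
    hexpos _, ?_⟩
  · exact (inter_eq_right.2 fun z (hz : z ∈ dom) => le_of_lt (show 0 < z 0 from hz.1)).symm
  · intro z hz z' hz' h
    have h1 := hmem z hz _ hz'.2.2 h
    have h2 := c.symm.injOn hz.2.1 hz'.2.1 h1
    rw [← hexlg z hz.1, h2, hexlg z' hz'.1]
  · intro z hz x' hx' h
    refine ⟨fun z => c.symm (lg z), ?_, hmem z hz x' hx' h, ?_⟩
    · exact (contMDiffAt_symm_of_mem_maximalAtlas hcm hz.2.1).comp z (hlgsm z hz.1).contMDiffAt
    · filter_upwards [mem_nhdsWithin_of_mem_nhds (hopen.mem_nhds hz)] with z' hz'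
      exact ⟨hz'.2.2, rfl⟩
  · intro z hz x' hx' h
    have h1 := hmem z hz x' hx' h
    have hsrc : x' ∈ c.source := h1 ▸ c.map_target hz.2.1
    refine ⟨fun x' => ex (c x'), ?_, ?_, ?_⟩
    · exact hexsm.contMDiff.contMDiffAt.comp x' (contMDiffAt_of_mem_maximalAtlas hcm hsrc)
    · simp only [← h1, c.right_inv hz.2.1, hexlg z hz.1]
    · filter_upwards [c.open_source.mem_nhds hsrc, D.isOpen_Q.mem_nhds hx'] with x₁ h2 h3
      refine ⟨⟨hexpos _, ?_, ?_⟩, ?_⟩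
      · rw [hlgex]
        exact c.map_source h2
      · rw [mem_preimage, hlgex, c.left_inv h2]
        exact h3
      · rw [hlgex, c.left_inv h2]
  -- The tube conditions are vacuous: all values are classes of points of `Q`.
  · intro z hz s y hy h
    exact (hF.not_mem_Q_of_boundary hz.2.2 hy h).elim
  · intro z hz s y hy h
    exact (hF.not_mem_Q_of_boundary hz.2.2 hy h).elim
  · refine ⟨hexpos _, ?_, ?_⟩
    · rw [hlgex]
      exact c.map_source (mem_chart_source _ x)
    · rw [mem_preimage, hlgex, c.left_inv (mem_chart_source _ x)]
      exact hx
  · simp only [hlgex]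
    rw [c.left_inv (mem_chart_source _ x)]

/-- A tube around part of `Y`, parametrized by a local parametrization of `Y` and a coordinate
change `χ` of the interval. -/
theorem isGood_tube (hF : D.IsGluing σ F) (c : LocalParam m Y) (s : ι) {χ χ' : ℝ → ℝ} {I J : Set ℝ}
    (hJ : IsOpen J) (hIJ : I = Ici 0 ∩ J) (hχ : ContDiffOn ℝ ∞ χ J) (hχ' : ContDiff ℝ ∞ χ')
    (hχs : ∀ t ∈ I, σ s = s → χ t ≤ 0) (hχ'I : ∀ t, (σ s = s → t ≤ 0) → χ' t ∈ I)
    (hχχ' : ∀ t, χ (χ' t) = t) (hχ'χ : ∀ t ∈ I, χ' (χ t) = t) :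
    D.IsGood σ F (fun z => D.tube σ F s (c.q (tailCoord z), χ (z 0)))
      {z | z 0 ∈ I ∧ |χ (z 0)| < D.ε ∧ tailCoord z ∈ c.V} := by
  have hsm : ∀ z : EuclideanSpace ℝ (Fin (m + 1)), z 0 ∈ J → tailCoord z ∈ c.V →
      ContDiffAt ℝ ∞ (fun z => (c.q (tailCoord z), χ (z 0))) z := by
    intro z hz hzV
    refine ContDiffAt.prodMk ?_ ?_
    · exact (c.contDiffOn_q.contDiffAt (c.isOpen_V.mem_nhds hzV)).comp z
        contDiff_tailCoord.contDiffAt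
    · exact (hχ.contDiffAt (hJ.mem_nhds hz)).comp z (contDiff_coord 0).contDiffAt
  have hsm' : ∀ w : EuclideanSpace ℝ (Fin n) × ℝ, w.1 ∈ c.O →
      ContDiffAt ℝ ∞ (fun w : EuclideanSpace ℝ (Fin n) × ℝ => consCoord (χ' w.2, c.r w.1)) w := by
    intro w hw
    refine contDiff_consCoord.contDiffAt.comp w (ContDiffAt.prodMk ?_ ?_)
    · exact (hχ'.comp contDiff_snd).contDiffAt
    · exact (c.contDiffOn_r.contDiffAt (c.isOpen_O.mem_nhds hw)).comp w contDiff_fst.contDiffAt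
  -- The coordinate change `χ` is smooth on the open set `J`, which may extend beyond the face; the
  -- sign condition on `χ` holds on `I` only.
  have hIJ' : I ⊆ J := hIJ ▸ inter_subset_right
  have hmk : ∀ w : EuclideanSpace ℝ (Fin n) × ℝ, w.1 ∈ Y → w.1 ∈ c.O → |w.2| < D.ε →
      (σ s = s → w.2 ≤ 0) →
      consCoord (χ' w.2, c.r w.1) ∈ {z : EuclideanSpace ℝ (Fin (m + 1)) |
        z 0 ∈ I ∧ |χ (z 0)| < D.ε ∧ tailCoord z ∈ c.V} ∧
      D.tube σ F s (c.q (tailCoord (consCoord (χ' w.2, c.r w.1))),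
        χ (consCoord (χ' w.2, c.r w.1) 0)) = D.tube σ F s w := by
    intro w hwY hwO hwε hs
    refine ⟨⟨hχ'I _ hs, ?_, c.r_mem _ hwO⟩, ?_⟩
    · simpa [hχχ'] using hwε
    · simp [hχχ', c.q_r _ hwO hwY]
  have hevO : ∀ w : EuclideanSpace ℝ (Fin n) × ℝ, w.1 ∈ c.O → |w.2| < D.ε →
      ∀ᶠ w' in 𝓝 w, w'.1 ∈ c.O ∧ |w'.2| < D.ε := fun w h1 h2 =>
    inter_mem ((c.isOpen_O.preimage continuous_fst).mem_nhds h1)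
      ((isOpen_lt (f := fun w : EuclideanSpace ℝ (Fin n) × ℝ => |w.2|)
        (by fun_prop) continuous_const).mem_nhds h2)
  refine ⟨?_, ?_, ?_, ?_, ?_, ?_⟩
  · refine ⟨{z | z 0 ∈ J ∩ χ ⁻¹' (Iio D.ε ∩ Ioi (-D.ε))} ∩ tailCoord ⁻¹' c.V, ?_, ?_⟩
    · exact ((hχ.continuousOn.isOpen_inter_preimage hJ (isOpen_Iio.inter isOpen_Ioi)).preimage
        (contDiff_coord 0 (r := 0)).continuous).inter
        (c.isOpen_V.preimage (contDiff_tailCoord (r := 0)).continuous)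
    · ext z
      subst hIJ
      constructor
      · rintro ⟨⟨h1, h2⟩, h3, h4⟩
        exact ⟨h1, ⟨h2, (abs_lt.1 h3).2, (abs_lt.1 h3).1⟩, h4⟩
      · rintro ⟨h1, ⟨h2, h3, h3'⟩, h4⟩
        exact ⟨⟨h1, h2⟩, abs_lt.2 ⟨h3', h3⟩, h4⟩
  · rintro z ⟨hz1, hz2, hz3⟩ z' ⟨hz1', hz2', hz3'⟩ h
    have h1 := hF.tube_injective (w := (c.q (tailCoord z), χ (z 0)))
      (w' := (c.q (tailCoord z'), χ (z' 0))) (c.q_mem _ hz3) hz2 (c.q_mem _ hz3') hz2'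
      (hχs _ hz1) (hχs _ hz1') h
    rw [Prod.mk.injEq] at h1
    rw [← consCoord_tailCoord z, ← consCoord_tailCoord z', ← c.r_q _ hz3, ← c.r_q _ hz3', h1.1,
      ← hχ'χ _ hz1, ← hχ'χ _ hz1', h1.2]
  · rintro z ⟨hz1, hz2, hz3⟩ x hx h
    obtain ⟨g, hg, hgx, hev⟩ := hF.exists_lift_of_tube
      (w := (c.q (tailCoord z), χ (z 0))) (c.q_mem _ hz3) hz2 hx h
    have hs := hsm z (hIJ' hz1) hz3
    refine ⟨fun z => g (c.q (tailCoord z), χ (z 0)), ?_, hgx, ?_⟩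
    · exact ContMDiffAt.comp z hg hs.contMDiffAt
    · have hV := (c.isOpen_V.preimage (contDiff_tailCoord (m := m) (r := 0)).continuous).mem_nhds hz3
      refine mem_nhdsWithin_of_mem_nhds ?_
      filter_upwards [hs.continuousAt.eventually hev, hV] with z' h1 h2
      exact h1 (c.q_mem _ h2)
  · rintro z ⟨hz1, hz2, hz3⟩ x hx h
    obtain ⟨g, hg, hgx, hev⟩ := hF.exists_colift_of_tube
      (w := (c.q (tailCoord z), χ (z 0))) (c.q_mem _ hz3) hz2 (hχs _ hz1) hx h
    have hO : (g x).1 ∈ c.O := by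
      rw [hgx]
      exact c.q_mem_O _ hz3
    refine ⟨fun x' => consCoord (χ' (g x').2, c.r (g x').1), ?_, ?_, ?_⟩
    · exact ContMDiffAt.comp (g := fun w : EuclideanSpace ℝ (Fin n) × ℝ => consCoord (χ' w.2, c.r w.1))
        x (hsm' _ hO).contMDiffAt hg
    · simp [hgx, hχ'χ _ hz1, c.r_q _ hz3]
    · have := hg.continuousAt.eventually (hevO (g x) hO (by rw [hgx]; exact hz2))
      filter_upwards [hev, this] with x' h1 h2
      have h3 := hmk (g x') h1.1 h2.1 h2.2 h1.2.1
      exact ⟨h3.1, h3.2.trans h1.2.2⟩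
  · rintro z ⟨hz1, hz2, hz3⟩ s' y hy h
    obtain ⟨h1, h2, δ, hδ, hδs, hδt⟩ := hF.tube_eq_boundary
      (w := (c.q (tailCoord z), χ (z 0))) (c.q_mem _ hz3) hz2 hy h
    rw [Prod.mk.injEq] at h1
    have hs := hsm z (hIJ' hz1) hz3
    refine ⟨fun z => (c.q (tailCoord z), δ * χ (z 0)), ?_, ?_, ?_⟩
    · exact hs.fst.prodMk (contDiffAt_const.mul hs.snd)
    · simp [h1.1, h1.2]
    · have hV := (c.isOpen_V.preimage (contDiff_tailCoord (m := m) (r := 0)).continuous).mem_nhds hz3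
      have hJ' := (hJ.preimage (contDiff_coord (m := m + 1) 0 (r := 0)).continuous).mem_nhds (hIJ' hz1)
      filter_upwards [mem_nhdsWithin_of_mem_nhds hV, mem_nhdsWithin_of_mem_nhds hJ',
        self_mem_nhdsWithin] with z' h3 h4 h5
      -- A point of the half space with first coordinate in `J` has it in `I`, where `χ ≤ 0` for a
      -- folded tube; in that case `δ = 1`.
      refine ⟨c.q_mem _ h3, fun hss => ?_, hδt _ (c.q_mem _ h3)⟩
      have hss' := h2.1 hss
      simp only [hδs hss', one_mul]
      exact hχs _ (hIJ ▸ ⟨h5, h4⟩) hss'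
  · rintro z ⟨hz1, hz2, hz3⟩ s' y hy h
    obtain ⟨h1, h2, δ, hδ, hδs, hδt⟩ := hF.tube_eq_boundary
      (w := (c.q (tailCoord z), χ (z 0))) (c.q_mem _ hz3) hz2 hy h
    rw [Prod.mk.injEq] at h1
    have hyO : y ∈ c.O := h1.1 ▸ c.q_mem_O _ hz3
    have hδδ : ∀ t : ℝ, δ * (δ * t) = t := fun t => by
      rcases hδ with rfl | rfl <;> simp
    have hfl : ContDiff ℝ ∞ fun w : EuclideanSpace ℝ (Fin n) × ℝ => (w.1, δ * w.2) := by fun_prop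
    refine ⟨fun w => consCoord (χ' (δ * w.2), c.r w.1), ?_, ?_, ?_⟩
    · exact ContDiffAt.comp (g := fun w : EuclideanSpace ℝ (Fin n) × ℝ => consCoord (χ' w.2, c.r w.1))
        (y, (0 : ℝ)) (hsm' (y, δ * 0) hyO) hfl.contDiffAt
    · have h3 : χ' 0 = z 0 := by rw [← h1.2, hχ'χ _ hz1]
      simp only [mul_zero, h3, ← h1.1, c.r_q _ hz3, consCoord_tailCoord]
    · have hev := (hfl.continuous.tendsto (y, 0)).eventually
        (hevO (y, δ * 0) hyO (by simpa using D.ε_pos))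
      filter_upwards [hev] with w h3 h4 h5
      have h6 := hmk (w.1, δ * w.2) h4 h3.1 h3.2 fun hss => by
        simpa only [hδs hss, one_mul] using h5 (h2.2 hss)
      refine ⟨h6.1, h6.2.trans ?_⟩
      rw [hδt (w.1, δ * w.2) h4]
      simp only [hδδ]

end CollaredDomain

/-! ### The glued manifold and its boundary -/

namespace CollaredDomain

variable {ι : Type*} {m n : ℕ} {X' : Type u} [TopologicalSpace X']
  [ChartedSpace (EuclideanSpace ℝ (Fin (m + 1))) X'] {Y : Set (EuclideanSpace ℝ (Fin n))}
  {D : CollaredDomain ι m X' Y} {σ : ι → ι}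

theorem equivalence_rel (hσ : Function.Involutive σ) : Equivalence (D.Rel σ) where
  refl _ := Or.inl rfl
  symm := by
    rintro x x' (h | ⟨s, y, hy, h1, h2⟩)
    · exact Or.inl h.symm
    · exact Or.inr ⟨σ s, y, hy, h2, (hσ s).symm ▸ h1⟩
  trans := by
    rintro x x' x'' (rfl | ⟨s, y, hy, h1, h2⟩) h
    · exact h
    · rcases h with rfl | ⟨s', y', hy', h3, h4⟩
      · exact Or.inr ⟨s, y, hy, h1, h2⟩
      · obtain ⟨h5, h6⟩ := D.β_injective (w := (y, 0)) (w' := (y', 0)) hy D.abs_zero_lt hy'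
          D.abs_zero_lt (h2.symm.trans h3)
        rw [← h5, hσ s, ← h6] at h4
        exact Or.inl (h1.trans h4.symm)

theorem continuousOn_β_zero (s : ι) : ContinuousOn (fun y => D.β s (y, 0)) Y := by
  intro y hy
  obtain ⟨g, hg, hgβ⟩ := D.exists_extension s (y, 0) hy D.abs_zero_lt
  have hc : Continuous fun y : EuclideanSpace ℝ (Fin n) => (y, (0 : ℝ)) := by fun_prop
  have h1 : ContinuousAt (fun y => g (y, 0)) y :=
    ContinuousAt.comp (g := g) (f := fun y => (y, (0 : ℝ))) hg.continuousAt hc.continuousAt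
  refine h1.continuousWithinAt.congr_of_eventuallyEq_of_mem ?_ hy
  filter_upwards [mem_nhdsWithin_of_mem_nhds ((hc.tendsto y).eventually hgβ), self_mem_nhdsWithin]
    with y' h2 h3
  exact (h2 h3).symm

/-- The relation is the diagonal together with finitely many compact images of `Y`. -/
theorem isClosed_rel [Finite ι] [T2Space X'] (hY : IsCompact Y) :
    IsClosed {q : X' × X' | D.Rel σ q.1 q.2} := by
  have : {q : X' × X' | D.Rel σ q.1 q.2}
      = diagonal X' ∪ ⋃ s, (fun y => (D.β s (y, 0), D.β (σ s) (y, 0))) '' Y := by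
    ext ⟨x, x'⟩
    simp only [Rel, mem_ofPred_eq, mem_union, mem_diagonal_iff, mem_iUnion, mem_image,
      Prod.mk.injEq]
    refine or_congr Iff.rfl (exists_congr fun s => exists_congr fun y => and_congr_right fun _ => ?_)
    rw [eq_comm, eq_comm (a := x')]
  rw [this]
  exact isClosed_diagonal.union (isClosed_iUnion_of_finite fun s =>
    (hY.image_of_continuousOn
      ((continuousOn_β_zero s).prodMk (continuousOn_β_zero (σ s)))).isClosed)

variable (D) in
theorem exists_isGluing [Finite ι] [T2Space X'] (hY : IsCompact Y) (hσ : Function.Involutive σ)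
    (hP : D.P.Nonempty) :
    ∃ (M : Type u) (_ : TopologicalSpace M) (_ : T2Space M) (_ : CompactSpace M) (F : X' → M),
      D.IsGluing σ F := by
  classical
  let S : Setoid D.P := (Setoid.mk (D.Rel σ) (equivalence_rel hσ)).comap Subtype.val
  have : CompactSpace D.P := isCompact_iff_compactSpace.1 D.isCompact_P
  have : T2Space (Quotient S) := t2Space_quotient_of_isClosed S
    ((isClosed_rel (D := D) (σ := σ) hY).preimage
      ((continuous_subtype_val.comp continuous_fst).prodMk
        (continuous_subtype_val.comp continuous_snd)))
  obtain ⟨x₀, hx₀⟩ := hP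
  -- The value off `P` is arbitrary; `IsGluing` only looks at points of `P`.
  let F : X' → Quotient S := fun x => if h : x ∈ D.P then ⟦⟨x, h⟩⟧ else ⟦⟨x₀, hx₀⟩⟧
  have hF : ∀ x (h : x ∈ D.P), F x = ⟦⟨x, h⟩⟧ := fun x h => dif_pos h
  refine ⟨Quotient S, inferInstance, inferInstance, inferInstance, F, hσ, ?_, ?_, ?_⟩
  · intro x hx x' hx'
    rw [hF x hx, hF x' hx', Quotient.eq]
    rfl
  · intro a
    obtain ⟨⟨x, hx⟩, rfl⟩ := Quotient.exists_rep a
    exact ⟨x, hx, hF x hx⟩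
  · intro T
    rw [← isQuotientMap_quotient_mk'.isOpen_preimage, isOpen_induced_iff]
    refine exists_congr fun G => and_congr_right fun _ => ?_
    constructor
    · intro h x hx
      rw [hF x hx]
      exact (Set.ext_iff.1 h ⟨x, hx⟩).symm
    · intro h
      ext ⟨x, hx⟩
      rw [mem_preimage, mem_preimage, ← h x hx, hF x hx]
      rfl

variable {M : Type*} [TopologicalSpace M] {F : X' → M}

/-- The collar meets `P` where its coordinate is nonpositive, whereas the half space is nonnegative,
hence the sign. -/
theorem isGood_boundaryCollar (hF : D.IsGluing σ F) (c : LocalParam m Y) {s : ι} (hs : σ s = s) :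
    D.IsGood σ F (fun z => D.tube σ F s (c.q (tailCoord z), -(z 0)))
      {z | z 0 ∈ Ici (0 : ℝ) ∧ |-(z 0)| < D.ε ∧ tailCoord z ∈ c.V} :=
  isGood_tube hF c s (χ := fun t => -t) (χ' := fun t => -t) (J := univ) isOpen_univ
    (inter_univ _).symm contDiff_neg.contDiffOn contDiff_neg
    (fun _ ht _ => neg_nonpos.2 ht) (fun _ ht => neg_nonneg.2 (ht hs)) neg_neg
    fun t _ => neg_neg t

/-- The logarithm makes both sides of the seam available within the open half space, the seam itself
being at `z 0 = 1`. -/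
theorem isGood_seam (hF : D.IsGluing σ F) (c : LocalParam m Y) {s : ι} (hs : σ s ≠ s) :
    D.IsGood σ F (fun z => D.tube σ F s (c.q (tailCoord z), Real.log (z 0)))
      {z | z 0 ∈ Ioi (0 : ℝ) ∧ |Real.log (z 0)| < D.ε ∧ tailCoord z ∈ c.V} :=
  isGood_tube hF c s (χ := Real.log) (χ' := Real.exp) (J := Ioi 0) isOpen_Ioi
    (inter_eq_right.2 Ioi_subset_Ici_self).symm
    (fun _ ht => (Real.contDiffAt_log.2 (ne_of_gt ht)).contDiffWithinAt) Real.contDiff_exp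
    (fun _ _ h => (hs h).elim) (fun t _ => Real.exp_pos t) Real.log_exp
    fun _ ht => Real.exp_log ht

theorem exists_param [IsManifold (𝓡 (m + 1)) ∞ X'] (hF : D.IsGluing σ F)
    (hY : IsSubmanifold ∞ m Y) {s₀ : ι} (hs₀ : ∀ s, σ s = s ↔ s = s₀) (a : M) :
    ∃ p : HalfSpaceParam m M, D.IsGood σ F p.toFun p.dom ∧ ∃ z ∈ p.dom, p.toFun z = a ∧
      (0 = z 0 ↔ ∃ y ∈ Y, a = F (D.β s₀ (y, 0))) := by
  obtain ⟨x, hx, rfl⟩ := hF.surjective a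
  by_cases hxQ : x ∈ D.Q
  · obtain ⟨p, dom, hp, z, hz, hz0, hpz⟩ := exists_isGood_of_mem_Q hF hxQ
    refine ⟨hp.toParam hF, hp, z, hz, hpz, fun h => (hz0.ne h).elim, ?_⟩
    rintro ⟨y, hy, h⟩
    exact (hF.not_mem_Q_of_boundary hxQ hy h).elim
  · obtain ⟨s, y, hy, rfl, -, -⟩ := boundary_of_not_mem_Q hx hxQ
    obtain ⟨c, hyc⟩ := hY.exists_localParam hy
    by_cases hs : σ s = s
    · have hp := isGood_boundaryCollar hF c hs
      refine ⟨hp.toParam hF, hp, consCoord (0, c.r y), ⟨le_refl (0 : ℝ), ?_, c.r_mem y hyc⟩, ?_, ?_⟩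
      · simpa using D.ε_pos
      · change D.tube σ F s (c.q (c.r y), -0) = _
        rw [c.q_r y hyc hy, neg_zero, tube_zero]
      · exact ⟨fun _ => ⟨y, hy, (hs₀ s).1 hs ▸ rfl⟩, fun _ => rfl⟩
    · have hp := isGood_seam hF c hs
      refine ⟨hp.toParam hF, hp, consCoord (1, c.r y), ⟨one_pos (α := ℝ), ?_, c.r_mem y hyc⟩, ?_, ?_⟩
      · simpa using D.ε_pos
      · change D.tube σ F s (c.q (c.r y), Real.log 1) = _
        rw [c.q_r y hyc hy, Real.log_one, tube_zero]
      · refine ⟨fun h => (zero_ne_one h).elim, ?_⟩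
        rintro ⟨y', hy', h⟩
        -- A class shared with the copy `s₀` would make `s` equal to `s₀`, hence fixed by `σ`.
        rcases ((hF.boundary_eq_iff hy hy').1 h).2 with h1 | h1
        · exact (hs ((hs₀ s).2 h1.symm)).elim
        · have h2 := (hs₀ s₀).2 rfl
          rw [h1, hF.involutive] at h2
          exact (hs h2.symm).elim

theorem bounds [Finite ι] [T2Space X'] [IsManifold (𝓡 (m + 1)) ∞ X']
    (D : CollaredDomain ι m X' Y) (hY : IsSubmanifold ∞ m Y) (hYc : IsCompact Y)
    (hσ : Function.Involutive σ) {s₀ : ι} (hs₀ : ∀ s, σ s = s ↔ s = s₀) : Bounds.{u} m Y := by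
  -- If `P` is empty, so is `Y`, which bounds the empty manifold.
  rcases D.P.eq_empty_or_nonempty with hP | hP
  · have hYe : IsEmpty Y := ⟨fun y => by
      have := (D.β_mem_P_iff (s := s₀) (w := (y.1, 0)) y.2 D.abs_zero_lt).2 le_rfl
      rw [hP] at this
      exact this⟩
    let := ChartedSpace.empty (EuclideanHalfSpace (m + 1)) PEmpty.{u + 1}
    exact ⟨PEmpty, inferInstance, inferInstance, inferInstance, inferInstance,
      IsManifold.empty _,
      Equiv.equivOfIsEmpty _ _, fun x => x.1.elim, fun y => hYe.elim y⟩
  obtain ⟨M, _, hT2, hcpt, F, hF⟩ := D.exists_isGluing hYc hσ hP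
  choose c hc z hz hcz hbd using exists_param hF hY hs₀
  have hmem : ∀ a, a ∈ (c a).toFun '' (c a).dom := fun a => ⟨z a, hz a, hcz a⟩
  let := HalfSpaceParam.chartedSpace {p | D.IsGood σ F p.toFun p.dom} c hc hmem
  have hman : IsManifold (𝓡∂ (m + 1)) ∞ M :=
    HalfSpaceParam.isManifold {p | D.IsGood σ F p.toFun p.dom} c hc hmem
      fun p hp q hq => hp.compatible hF hq
  have hfix : σ s₀ = s₀ := (hs₀ s₀).2 rfl
  -- The boundary is read off the preferred chart at each point, chosen so that exactly the classes
  -- in the copy `s₀` lie on the face.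
  have hboundary : ∀ a : M, a ∈ (𝓡∂ (m + 1)).boundary M ↔ ∃ y ∈ Y, a = F (D.β s₀ (y, 0)) := by
    intro a
    rw [← hbd a]
    change extChartAt (𝓡∂ (m + 1)) a a ∈ frontier (range (𝓡∂ (m + 1))) ↔ _
    rw [frontier_range_modelWithCornersEuclideanHalfSpace]
    have h1 : extChartAt (𝓡∂ (m + 1)) a a = ((c a).chart a).1 := rfl
    have h2 := (c a).chart_apply (hz a)
    rw [hcz a] at h2
    rw [h1, h2]
    rfl
  let f : Y → (𝓡∂ (m + 1)).boundary M := fun y =>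
    ⟨F (D.β s₀ (y, 0)), (hboundary _).2 ⟨y, y.2, rfl⟩⟩
  have hf : Function.Bijective f := by
    constructor
    · intro y y' h
      exact Subtype.ext ((hF.boundary_eq_iff y.2 y'.2).1 (congrArg Subtype.val h)).1
    · rintro ⟨a, ha⟩
      obtain ⟨y, hy, h⟩ := (hboundary a).1 ha
      exact ⟨⟨y, hy⟩, Subtype.ext h.symm⟩
  let e : Y ≃ (𝓡∂ (m + 1)).boundary M := Equiv.ofBijective f hf
  have hatlas : ∀ p : HalfSpaceParam m M, D.IsGood σ F p.toFun p.dom →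
      p.chart ∈ IsManifold.maximalAtlas (𝓡∂ (m + 1)) ∞ M := fun p hp =>
    IsManifold.subset_maximalAtlas ⟨p, hp, rfl⟩
  refine ⟨M, inferInstance, hT2, hcpt, inferInstance, hman, e.symm, ?_, ?_⟩
  · intro x
    obtain ⟨y, rfl⟩ := e.surjective x
    obtain ⟨d, hyd⟩ := hY.exists_localParam y.2
    have hp := isGood_boundaryCollar hF d hfix
    have hpa := hatlas (hp.toParam hF) hp
    refine ⟨(hp.toParam hF).chart.source, (hp.toParam hF).chart.open_source, ?_,
      fun a => d.q (tailCoord ((hp.toParam hF).chart.extend (𝓡∂ (m + 1)) a)), ?_, ?_⟩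
    · rw [HalfSpaceParam.chart_source]
      refine ⟨consCoord (0, d.r y), ⟨le_refl (0 : ℝ), ?_, d.r_mem y hyd⟩, ?_⟩
      · simpa using D.ε_pos
      · change D.tube σ F s₀ (d.q (d.r y), -0) = _
        rw [d.q_r y hyd y.2, neg_zero, tube_zero]
        rfl
    · refine (d.contDiffOn_q.comp contDiff_tailCoord.contDiffOn fun v hv => hv).contMDiffOn.comp
        (OpenPartialHomeomorph.contMDiffOn_extend hpa) ?_
      intro a ha
      rw [HalfSpaceParam.chart_source] at ha
      obtain ⟨v, hv, rfl⟩ := ha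
      have h1 := (hp.toParam hF).chart_apply hv
      change tailCoord (((hp.toParam hF).chart ((hp.toParam hF).toFun v)).1) ∈ d.V
      rw [h1]
      exact hv.2.2
    · intro a ha
      obtain ⟨y', rfl⟩ := e.surjective a
      have h0 : e.symm (e y') = y' := e.symm_apply_apply y'
      rw [HalfSpaceParam.chart_source] at ha
      obtain ⟨v, hv, hva⟩ := ha
      have h1 := (hp.toParam hF).chart_apply hv
      change d.q (tailCoord (((hp.toParam hF).chart (e y' : M)).1)) =
        (e.symm (e y') : EuclideanSpace ℝ (Fin n))
      rw [h0, ← hva, h1]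
      have h2 : D.tube σ F s₀ (d.q (tailCoord v), -(v 0)) = F (D.β s₀ (y', 0)) := hva
      have h3 := (hF.tube_eq_boundary (w := (d.q (tailCoord v), -(v 0))) (d.q_mem _ hv.2.2)
        hv.2.1 y'.2 h2).1
      exact congrArg Prod.fst h3
  · intro y
    obtain ⟨d, hyd⟩ := hY.exists_localParam y.2
    have hp := isGood_boundaryCollar hF d hfix
    have hpa := hatlas (hp.toParam hF) hp
    have hdom : ∀ y' ∈ d.O, consCoord (0, d.r y') ∈ (hp.toParam hF).dom := fun y' hy' =>
      ⟨le_refl (0 : ℝ), by simpa using D.ε_pos, d.r_mem y' hy'⟩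
    refine ⟨d.O, d.isOpen_O, hyd,
      fun y' => ((hp.toParam hF).chart.extend (𝓡∂ (m + 1))).symm (consCoord (0, d.r y')), ?_, ?_⟩
    · refine (contMDiffOn_extend_symm hpa).comp (contDiff_consCoord.comp_contDiffOn
        (contDiffOn_const.prodMk d.contDiffOn_r)).contMDiffOn ?_
      intro y' hy'
      exact ⟨⟨consCoord (0, d.r y'), le_rfl⟩, hdom y' hy', rfl⟩
    · intro y' hy'
      change (hp.toParam hF).toFun ((𝓡∂ (m + 1)).symm (consCoord (0, d.r y'))).1 = (e y' : M)
      have h1 : (𝓡∂ (m + 1)).symm (consCoord (0, d.r y')) = ⟨consCoord (0, d.r y'), le_rfl⟩ :=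
        (𝓡∂ (m + 1)).left_inv ⟨consCoord (0, d.r y'), le_rfl⟩
      rw [h1]
      change D.tube σ F s₀ (d.q (d.r y'), -0) = _
      rw [d.q_r y' hy' y'.2, neg_zero, tube_zero]
      rfl

end CollaredDomain

/-! ### Smooth maps and diffeomorphisms between subsets -/

section Maps

variable {EP HP P EQ HQ Q : Type*}
  [NormedAddCommGroup EP] [NormedSpace ℝ EP] [TopologicalSpace HP]
  [TopologicalSpace P] [ChartedSpace HP P]
  [NormedAddCommGroup EQ] [NormedSpace ℝ EQ] [TopologicalSpace HQ]
  [TopologicalSpace Q] [ChartedSpace HQ Q]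
  {I : ModelWithCorners ℝ EP HP} {J : ModelWithCorners ℝ EQ HQ} {r : WithTop ℕ∞}

theorem IsSmoothOnSubset.continuousOn {S : Set P} {f : P → Q}
    (h : IsSmoothOnSubset I J r (fun x : S => f x)) : ContinuousOn f S := by
  intro x hx
  obtain ⟨O, hO, hxO, g, hg, hgf⟩ := h ⟨x, hx⟩
  have h1 : ContinuousAt g x := (hg.contMDiffAt (hO.mem_nhds hxO)).continuousAt
  refine h1.continuousWithinAt.congr_of_eventuallyEq_of_mem ?_ hx
  filter_upwards [mem_nhdsWithin_of_mem_nhds (hO.mem_nhds hxO), self_mem_nhdsWithin] with y h2 h3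
  exact (hgf ⟨y, h3⟩ h2).symm

/-- A diffeomorphism between subsets and its inverse, extended to the ambient spaces. -/
theorem IsDiffeo.exists_extension [Nonempty P] [Nonempty Q] {S : Set P} {T : Set Q} {e : S ≃ T}
    (h : IsDiffeo I J r e) :
    ∃ (f : P → Q) (g : Q → P), (∀ x : S, f x = e x) ∧ (∀ y : T, g y = e.symm y) ∧
      IsSmoothOnSubset I J r (fun x : S => f x) ∧ IsSmoothOnSubset J I r (fun y : T => g y) := by
  classical
  obtain ⟨p⟩ := ‹Nonempty P›
  obtain ⟨q⟩ := ‹Nonempty Q›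
  have hf : ∀ x : S, (fun x => if hx : x ∈ S then (e ⟨x, hx⟩ : Q) else q) x = e x :=
    fun x => dif_pos x.2
  have hg : ∀ y : T, (fun y => if hy : y ∈ T then (e.symm ⟨y, hy⟩ : P) else p) y = e.symm y :=
    fun y => dif_pos y.2
  refine ⟨fun x => if hx : x ∈ S then (e ⟨x, hx⟩ : Q) else q,
    fun y => if hy : y ∈ T then (e.symm ⟨y, hy⟩ : P) else p, hf, hg, ?_, ?_⟩
  · simpa only [hf] using h.smooth
  · simpa only [hg] using h.smooth_symm

end Maps

theorem exists_isOpen_smoothPart_eq {n : ℕ} (k : ℕ) (X : Set (EuclideanSpace ℝ (Fin n))) :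
    ∃ O : Set (EuclideanSpace ℝ (Fin n)), IsOpen O ∧ smoothPart k X = X ∩ O := by
  refine ⟨{x | ∃ N : Set (EuclideanSpace ℝ (Fin n)), IsOpen N ∧ x ∈ N ∧
    IsSubmanifold ω k (X ∩ N)}, ?_, rfl⟩
  rw [isOpen_iff_forall_mem_open]
  rintro x ⟨N, hN, hx, h⟩
  exact ⟨N, fun y hy => ⟨N, hN, hy, h⟩, hN, hx⟩

/-! ### Sheets -/

section Sheets

variable {n k : ℕ} {X' : Type u} [TopologicalSpace X'] [ChartedSpace (EuclideanSpace ℝ (Fin k)) X']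
  {φ : X' → EuclideanSpace ℝ (Fin n)} {U W : Set (EuclideanSpace ℝ (Fin n))} {A B : Set X'}

/-- The inverse of `φ` on a sheet, made total on the ambient space; only its values on `W` matter.
-/
theorem exists_section_of_mem_sheets (hA : A ∈ sheets (k := k) φ U W) (hW : W.Nonempty) :
    ∃ γ : EuclideanSpace ℝ (Fin n) → X', (∀ w ∈ W, γ w ∈ A ∧ φ (γ w) = w) ∧
      (∀ a ∈ A, φ a ∈ W ∧ γ (φ a) = a) ∧ IsSmoothOnSubset (𝓡 n) (𝓡 k) ω (fun w : W => γ w) := by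
  obtain ⟨-, -, e, he, heφ⟩ := hA
  obtain ⟨w₀, hw₀⟩ := hW
  have : Nonempty X' := ⟨e.symm ⟨w₀, hw₀⟩⟩
  obtain ⟨-, γ, -, hγ, -, hsm⟩ := he.exists_extension
  refine ⟨γ, fun w hw => ?_, fun a ha => ?_, hsm⟩
  · rw [hγ ⟨w, hw⟩]
    exact ⟨(e.symm ⟨w, hw⟩).2, by rw [← heφ, Equiv.apply_symm_apply]⟩
  · rw [← heφ ⟨a, ha⟩]
    exact ⟨(e ⟨a, ha⟩).2, by rw [hγ, Equiv.symm_apply_apply]⟩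

theorem isPreconnected_of_mem_sheets (hA : A ∈ sheets (k := k) φ U W) (hW : W.Nonempty)
    (hWc : IsPreconnected W) : IsPreconnected A := by
  obtain ⟨γ, h1, h2, h3⟩ := exists_section_of_mem_sheets hA hW
  have : A = γ '' W := by
    ext a
    constructor
    · exact fun ha => ⟨φ a, h2 a ha⟩
    · rintro ⟨w, hw, rfl⟩
      exact (h1 w hw).1
  rw [this]
  exact hWc.image _ h3.continuousOn

/-- A sheet is connected, being a continuous image of `W`, and every sheet is open and closed in
`φ⁻¹(U)`. Distinct sheets are therefore disjoint, and so are the copies of `Y` in them. -/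
theorem subset_of_mem_sheets (hA : A ∈ sheets (k := k) φ U W) (hB : B ∈ sheets (k := k) φ U W)
    (hW : W.Nonempty) (hWc : IsPreconnected W) {x : X'} (hxA : x ∈ A) (hxB : x ∈ B) : A ⊆ B := by
  have h1 : IsPreconnected ((↑) ⁻¹' A : Set (φ ⁻¹' U)) := by
    rw [← IsInducing.subtypeVal.isPreconnected_image, Subtype.image_preimage_coe,
      inter_eq_right.2 hA.1]
    exact isPreconnected_of_mem_sheets hA hW hWc
  have h2 := h1.subset_isClopen hB.2.1 ⟨⟨x, hA.1 hxA⟩, hxA, hxB⟩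
  exact fun a ha => h2 (a := ⟨a, hA.1 ha⟩) ha

theorem eq_of_mem_sheets (hA : A ∈ sheets (k := k) φ U W) (hB : B ∈ sheets (k := k) φ U W)
    (hW : W.Nonempty) (hWc : IsPreconnected W) {x : X'} (hxA : x ∈ A) (hxB : x ∈ B) : A = B :=
  (subset_of_mem_sheets hA hB hW hWc hxA hxB).antisymm
    (subset_of_mem_sheets hB hA hW hWc hxB hxA)

theorem isOpen_of_mem_sheets (hA : A ∈ sheets (k := k) φ U W) (hU : IsOpen (φ ⁻¹' U)) :
    IsOpen A := by
  have h := hU.isOpenMap_subtype_val _ hA.2.1.isOpen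
  rwa [Subtype.image_preimage_coe, inter_eq_right.2 hA.1] at h

end Sheets

/-! ### Collars -/

/-- A collar of a compact subset `Y` of a component `W` of `U` maps a neighbourhood of `Y × {0}`
into `W`. -/
theorem exists_collar_subset {n : ℕ} {X Y T U W : Set (EuclideanSpace ℝ (Fin n))}
    {Ψ : EuclideanSpace ℝ (Fin n) × ℝ → EuclideanSpace ℝ (Fin n)} (hYc : IsCompact Y)
    (hTX : T ⊆ X) (hU : ∃ O : Set (EuclideanSpace ℝ (Fin n)), IsOpen O ∧ U = X ∩ O)
    (hW : ∃ x ∈ U, W = connectedComponentIn U x) (hΨ : ContinuousOn Ψ (Y ×ˢ Ioo (-1) 1))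
    (hΨT : ∀ w ∈ Y ×ˢ Ioo (-1 : ℝ) 1, Ψ w ∈ T) (hΨY : ∀ y ∈ Y, Ψ (y, 0) ∈ W) :
    ∃ ε, 0 < ε ∧ ε ≤ 1 ∧ ∀ w : EuclideanSpace ℝ (Fin n) × ℝ, w.1 ∈ Y → |w.2| < ε → Ψ w ∈ W := by
  obtain ⟨O, hO, rfl⟩ := hU
  obtain ⟨x, hx, rfl⟩ := hW
  obtain ⟨G, hG, hGeq⟩ := continuousOn_iff'.1 hΨ O hO
  have h0 : Y ×ˢ {(0 : ℝ)} ⊆ G := by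
    rintro ⟨y, t⟩ ⟨hy, ht⟩
    obtain rfl : t = 0 := ht
    have h1 : (y, (0 : ℝ)) ∈ Ψ ⁻¹' O ∩ Y ×ˢ Ioo (-1) 1 :=
      ⟨(connectedComponentIn_subset _ _ (hΨY y hy)).2, hy, by norm_num, by norm_num⟩
    rw [hGeq] at h1
    exact h1.1
  -- Compactness of `Y` gives a uniform width on which the collar stays in `U`. Each segment over a
  -- point of `Y` is connected and meets `W`, hence lies in `W`.
  obtain ⟨A, B, -, hB, hYA, h0B, hAB⟩ := generalized_tube_lemma hYc isCompact_singleton hG h0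
  obtain ⟨δ, hδ, hδB⟩ := Metric.isOpen_iff.1 hB 0 (h0B rfl)
  have hmem : ∀ w : EuclideanSpace ℝ (Fin n) × ℝ, w.1 ∈ Y → |w.2| < min δ 1 →
      w ∈ Y ×ˢ Ioo (-1 : ℝ) 1 := fun w hw hwε =>
    ⟨hw, abs_lt.1 (hwε.trans_le (min_le_right _ _))⟩
  refine ⟨min δ 1, lt_min hδ one_pos, min_le_right _ _, fun w hw hwε => ?_⟩
  have hsub : Ψ '' ({w.1} ×ˢ Ioo (-min δ 1) (min δ 1)) ⊆ X ∩ O := by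
    rintro _ ⟨⟨y, t⟩, ⟨hy, ht⟩, rfl⟩
    obtain rfl : y = w.1 := hy
    have ht' : |t| < min δ 1 := abs_lt.2 ht
    have h1 := hmem (w.1, t) hw ht'
    refine ⟨hTX (hΨT _ h1), ?_⟩
    have h2 : (w.1, t) ∈ G ∩ Y ×ˢ Ioo (-1 : ℝ) 1 :=
      ⟨hAB ⟨hYA hw, hδB (by simpa using ht'.trans_le (min_le_left _ _))⟩, h1⟩
    rw [← hGeq] at h2
    exact h2.1
  have hconn : IsPreconnected (Ψ '' ({w.1} ×ˢ Ioo (-min δ 1) (min δ 1))) := by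
    refine (isPreconnected_singleton.prod isPreconnected_Ioo).image _ (hΨ.mono ?_)
    rintro ⟨y, t⟩ ⟨hy, ht⟩
    obtain rfl : y = w.1 := hy
    exact hmem (w.1, t) hw (abs_lt.2 ht)
  have h1 : Ψ (w.1, 0) ∈ Ψ '' ({w.1} ×ˢ Ioo (-min δ 1) (min δ 1)) :=
    ⟨(w.1, 0), ⟨rfl, abs_lt.1 (by simpa using hδ)⟩, rfl⟩
  have h2 := hconn.subset_connectedComponentIn h1 hsub
  rw [← connectedComponentIn_eq (hΨY w.1 hw)] at h2
  exact h2 ⟨w, ⟨rfl, abs_lt.1 hwε⟩, rfl⟩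

/-! ### The preimage of the domain bounded by an equator -/

section Preimage

variable {n m : ℕ} {X : Set (EuclideanSpace ℝ (Fin n))} {X' : Type u} [TopologicalSpace X']
  [ChartedSpace (EuclideanSpace ℝ (Fin (m + 1))) X'] {φ : X' → EuclideanSpace ℝ (Fin n)}
  {U W Y : Set (EuclideanSpace ℝ (Fin n))}

/-- If an equator bounds the set `K`, the preimage of the closure of `K` is a domain whose boundary
components are the preimages of the equator in the sheets. -/
theorem exists_collaredDomain (hΓ : IsGlobalSmoothingSection (k := m + 1) X φ U)
    (hW : ∃ x ∈ U, W = connectedComponentIn U x) (hYW : Y ⊆ W)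
    (hY : IsNonboundingEquator.{u} (m + 1) X Y) :
    Nonempty (CollaredDomain (sheets (k := m + 1) φ U W) m X' Y) := by
  obtain ⟨T, ψ, K, hTX, hYT, ⟨O, hO, hTO⟩, hψ, hψY, ⟨O', hO', hKO⟩, hKc, hKY, hKT⟩ := hY.collar
  obtain ⟨O₁, hO₁, hsm⟩ := exists_isOpen_smoothPart_eq (m + 1) X
  have hWne : W.Nonempty := by
    obtain ⟨x, hx, rfl⟩ := hW
    exact ⟨x, mem_connectedComponentIn hx⟩
  have hWc : IsPreconnected W := by
    obtain ⟨x, -, rfl⟩ := hW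
    exact isPreconnected_connectedComponentIn
  have hφc : Continuous φ := hΓ.analytic.continuous
  have hφX : ∀ x, φ x ∈ X := fun x => hΓ.range_subset ⟨x, rfl⟩
  -- As `φ` takes values in `X`, sets open only relative to `X` have open preimages.
  have hopen : ∀ S O : Set (EuclideanSpace ℝ (Fin n)), IsOpen O → S = X ∩ O →
      IsOpen (φ ⁻¹' S) := by
    rintro S O hO rfl
    rw [show φ ⁻¹' (X ∩ O) = φ ⁻¹' O from inter_eq_right.2 fun x _ => hφX x]
    exact hO.preimage hφc
  have hφU : IsOpen (φ ⁻¹' U) := by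
    obtain ⟨O, hO, h⟩ := hΓ.isOpen
    exact hopen U O hO h
  have hφT : IsOpen (φ ⁻¹' T) := hopen T (O₁ ∩ O) (hO₁.inter hO) (by
    rw [hTO, hsm, inter_assoc])
  obtain ⟨Ψ, Θ, hΨe, hΘe, hΨs, hΘs⟩ := hψ.exists_extension
  have hΨT : ∀ w ∈ Y ×ˢ Ioo (-1 : ℝ) 1, Ψ w ∈ T ∧ Θ (Ψ w) = w := by
    intro w hw
    rw [hΨe ⟨w, hw⟩, hΘe, Equiv.symm_apply_apply]
    exact ⟨(ψ ⟨w, hw⟩).2, rfl⟩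
  have hΘT : ∀ x ∈ T, Θ x ∈ Y ×ˢ Ioo (-1 : ℝ) 1 ∧ Ψ (Θ x) = x := by
    intro x hx
    rw [hΘe ⟨x, hx⟩, hΨe, Equiv.apply_symm_apply]
    exact ⟨(ψ.symm ⟨x, hx⟩).2, rfl⟩
  have hTY : ∀ x ∈ T, x ∈ Y ↔ (Θ x).2 = 0 := by
    intro x hx
    rw [← hψY]
    constructor
    · rintro ⟨p, hp, rfl⟩
      change (Θ (ψ p)).2 = 0
      rw [← hΨe, (hΨT p p.2).2]
      exact hp
    · intro h
      exact ⟨⟨Θ x, (hΘT x hx).1⟩, h, by simpa only [← hΨe] using (hΘT x hx).2⟩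
  have hTK : ∀ x ∈ T, x ∈ K ↔ (Θ x).2 < 0 := by
    intro x hx
    have : x ∈ K ↔ x ∈ K ∩ T := ⟨fun h => ⟨h, hx⟩, fun h => h.1⟩
    rw [this, hKT]
    constructor
    · rintro ⟨p, hp, rfl⟩
      change (Θ (ψ p)).2 < 0
      rw [← hΨe, (hΨT p p.2).2]
      exact hp
    · intro h
      exact ⟨⟨Θ x, (hΘT x hx).1⟩, h, by simpa only [← hΨe] using (hΘT x hx).2⟩
  have hclK : ∀ x, x ∈ closure K ↔ x ∈ K ∨ x ∈ Y := by
    intro x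
    rw [← hKY]
    constructor
    · exact fun h => (em (x ∈ K)).imp id fun h' => ⟨h, h'⟩
    · rintro (h | h)
      · exact subset_closure h
      · exact h.1
  have hzero : ∀ y ∈ Y, (y, (0 : ℝ)) ∈ Y ×ˢ Ioo (-1 : ℝ) 1 := fun y hy =>
    ⟨hy, by norm_num, by norm_num⟩
  -- The collar need not fix `Y` pointwise: `Ψ (y, 0)` is only some point of `Y`.
  have hΨY : ∀ y ∈ Y, Ψ (y, 0) ∈ Y := fun y hy => by
    rw [hTY _ (hΨT _ (hzero y hy)).1, (hΨT _ (hzero y hy)).2]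
  obtain ⟨ε, hε, hε1, hεW⟩ := exists_collar_subset hY.isCompact (fun x hx => (hTX hx).1) hΓ.isOpen
    hW hΨs.continuousOn (fun w hw => (hΨT w hw).1) fun y hy => hYW (hΨY y hy)
  have hεmem : ∀ w : EuclideanSpace ℝ (Fin n) × ℝ, w.1 ∈ Y → |w.2| < ε →
      w ∈ Y ×ˢ Ioo (-1 : ℝ) 1 := fun w hw hwε => ⟨hw, abs_lt.1 (hwε.trans_le hε1)⟩
  have hρ : ContMDiffOn (𝓡 (m + 1)) 𝓘(ℝ, EuclideanSpace ℝ (Fin n) × ℝ) ∞ (Θ ∘ φ) (φ ⁻¹' T) := by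
    intro x hx
    obtain ⟨N, hN, hxN, g, hg, hgΘ⟩ := hΘs ⟨φ x, hx⟩
    have h1 : ContMDiffAt (𝓡 (m + 1)) 𝓘(ℝ, EuclideanSpace ℝ (Fin n) × ℝ) ∞ (g ∘ φ) x :=
      (hg.contMDiffAt (hN.mem_nhds hxN)).comp x ((hΓ.analytic x).of_le le_top)
    refine (h1.congr_of_eventuallyEq ?_).contMDiffWithinAt
    filter_upwards [hφT.mem_nhds hx, (hN.preimage hφc).mem_nhds hxN] with x' h2 h3
    exact (hgΘ ⟨φ x', h2⟩ h3).symm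
  -- The collar `Ψ` is lifted to each sheet by its section, while the single map `Θ ∘ φ` inverts all
  -- the lifts.
  choose γ hγ hγ' hγs using fun s : sheets (k := m + 1) φ U W =>
    exists_section_of_mem_sheets s.2 hWne
  refine ⟨{
    P := φ ⁻¹' closure K
    Q := φ ⁻¹' K
    Ω := fun s => s.1 ∩ (φ ⁻¹' T ∩ (Θ ∘ φ) ⁻¹' {w | |w.2| < ε})
    β := fun s w => γ s (Ψ w)
    ρ := Θ ∘ φ
    ε := ε
    ε_pos := hε
    isCompact_P := hΓ.proper.isCompact_preimage hKc
    isOpen_Q := hopen K O' hO' hKO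
    subset := preimage_mono subset_closure
    isOpen_Ω := fun s => (isOpen_of_mem_sheets s.2 hφU).inter
      (hρ.continuousOn.isOpen_inter_preimage hφT (isOpen_lt (by fun_prop) continuous_const))
    eq_of_mem := fun s s' x hx hx' =>
      Subtype.ext (eq_of_mem_sheets s.2 s'.2 hWne hWc hx.1 hx'.1)
    β_mem := ?_
    ρ_β := ?_
    ρ_mem := fun s x hx => ⟨(hΘT _ hx.2.1).1.1, hx.2.2⟩
    β_ρ := ?_
    contMDiffOn_ρ := fun s => hρ.mono fun x hx => hx.2.1
    exists_extension := ?_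
    mem_Q := fun s x hx => hTK _ hx.2.1
    mem_P := ?_
    exists_mem_Ω := ?_ }⟩
  · intro s w hw hwε
    have h1 := hγ s _ (hεW w hw hwε)
    have h2 := hΨT w (hεmem w hw hwε)
    refine ⟨h1.1, ?_, ?_⟩
    · rw [mem_preimage, h1.2]
      exact h2.1
    · change |(Θ (φ (γ s (Ψ w)))).2| < ε
      rw [h1.2, h2.2]
      exact hwε
  · intro s w hw hwε
    change Θ (φ (γ s (Ψ w))) = w
    rw [(hγ s _ (hεW w hw hwε)).2, (hΨT w (hεmem w hw hwε)).2]
  · intro s x hx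
    change γ s (Ψ (Θ (φ x))) = x
    rw [(hΘT _ hx.2.1).2, (hγ' s x hx.1).2]
  · intro s w hw hwε
    obtain ⟨N, hN, hwN, g, hg, hgΨ⟩ := hΨs ⟨w, hεmem w hw hwε⟩
    obtain ⟨N', hN', hwN', g', hg', hgγ⟩ := hγs s ⟨Ψ w, hεW w hw hwε⟩
    have hgw : g w = Ψ w := hgΨ ⟨w, hεmem w hw hwε⟩ hwN
    have h1 := hg.contMDiffAt (hN.mem_nhds hwN)
    have h2 : ContMDiffAt (𝓡 n) (𝓡 (m + 1)) ∞ g' (g w) := by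
      rw [hgw]
      exact (hg'.contMDiffAt (hN'.mem_nhds hwN')).of_le le_top
    refine ⟨g' ∘ g, h2.comp w h1, ?_⟩
    have h3 : ∀ᶠ w' : EuclideanSpace ℝ (Fin n) × ℝ in 𝓝 w, |w'.2| < ε :=
      (isOpen_lt (by fun_prop) continuous_const).mem_nhds hwε
    have h4 : ∀ᶠ w' in 𝓝 w, g w' ∈ N' :=
      h1.continuousAt.preimage_mem_nhds (hN'.mem_nhds (show g w ∈ N' by rwa [hgw]))
    filter_upwards [h3, h4, hN.mem_nhds hwN] with w' h5 h6 h7 h8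
    have h9 : g w' = Ψ w' := hgΨ ⟨w', hεmem w' h8 h5⟩ h7
    rw [Function.comp_apply, h9]
    exact hgγ ⟨Ψ w', hεW w' h8 h5⟩ (show Ψ w' ∈ N' by rwa [← h9])
  · intro s x hx
    rw [mem_preimage, hclK, hTK _ hx.2.1, hTY _ hx.2.1, le_iff_lt_or_eq]
    rfl
  · intro x hx hx'
    -- A point of `P` outside `Q` lies over `Y ⊆ W`, hence in a sheet.
    have hxY : φ x ∈ Y := ((hclK _).1 hx).resolve_left hx'
    have hxs : x ∈ ⋃₀ sheets (k := m + 1) φ U W := by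
      obtain ⟨x₀, hx₀, rfl⟩ := hW
      rw [hΓ.sUnion_sheets x₀ hx₀]
      exact hYW hxY
    obtain ⟨A, hA, hxA⟩ := hxs
    refine ⟨⟨A, hA⟩, hxA, hYT hxY, ?_⟩
    change |(Θ (φ x)).2| < ε
    rw [(hTY _ (hYT hxY)).1 hxY, abs_zero]
    exact hε

end Preimage

/-- A finite set with an odd number of elements has an involution with exactly one fixed point. -/
theorem exists_involutive_of_odd_card {ι : Type*} (h : Odd (Nat.card ι)) :
    ∃ σ : ι → ι, Function.Involutive σ ∧ ∃ s₀, ∀ s, σ s = s ↔ s = s₀ := by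
  have : Finite ι := Nat.finite_of_card_ne_zero h.pos.ne'
  obtain ⟨j, hj⟩ := h
  let e : ι ≃ Fin (2 * j + 1) := hj ▸ Finite.equivFin ι
  -- Reversing `0, …, 2j` fixes only the middle element `j`.
  refine ⟨fun s => e.symm (e s).rev, fun s => by simp, e.symm ⟨j, by omega⟩, fun s => ?_⟩
  rw [Equiv.symm_apply_eq, Equiv.eq_symm_apply, Fin.ext_iff, Fin.ext_iff,
    Fin.val_rev]
  have := (e s).isLt
  simp only
  omega

end GlobalSmoothing

/-! ### The parity of the degree -/

theorem theorem2p2 {n k : ℕ} (X : Set (EuclideanSpace ℝ (Fin n)))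
    (hXclosed : IsClosed X) (hXsub : GlobalSmoothing.IsSubanalytic X)
    (hXdim : GlobalSmoothing.subanalyticDim X = ((k : ℕ∞) : WithBot ℕ∞))
    (X' : Type u) [TopologicalSpace X'] [T2Space X'] [SecondCountableTopology X']
    [ChartedSpace (EuclideanSpace ℝ (Fin k)) X'] [IsManifold (𝓡 k) ω X']
    (φ : X' → EuclideanSpace ℝ (Fin n)) (U : Set (EuclideanSpace ℝ (Fin n)))
    (hΓ : GlobalSmoothing.IsGlobalSmoothingSection (k := k) X φ U)
    (W : Set (EuclideanSpace ℝ (Fin n))) (hW : ∃ x ∈ U, W = connectedComponentIn U x)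
    (hY : ∃ Y : Set (EuclideanSpace ℝ (Fin n)),
      Y ⊆ W ∧ GlobalSmoothing.IsNonboundingEquator.{u} k X Y) :
    Even (GlobalSmoothing.degree (k := k) φ U W) := by
  obtain ⟨Y, hYW, hY⟩ := hY
  obtain ⟨m, rfl⟩ : ∃ m, k = m + 1 := ⟨k - 1, (Nat.sub_add_cancel hY.one_le).symm⟩
  by_contra hodd
  rw [Nat.not_even_iff_odd] at hodd
  have hodd' : Odd (Nat.card (GlobalSmoothing.sheets (k := m + 1) φ U W)) := hodd
  -- An infinite type has `Nat.card` equal to `0`, which is not odd.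
  have : Finite (GlobalSmoothing.sheets (k := m + 1) φ U W) :=
    Nat.finite_of_card_ne_zero hodd'.pos.ne'
  have : IsManifold (𝓡 (m + 1)) ∞ X' := IsManifold.of_le (n := ω) le_top
  obtain ⟨σ, hσ, s₀, hs₀⟩ := GlobalSmoothing.exists_involutive_of_odd_card hodd'
  obtain ⟨D⟩ := GlobalSmoothing.exists_collaredDomain hΓ hW hYW hY
  exact hY.not_bounds (D.bounds hY.isSubmanifold hY.isCompact hσ hs₀)
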